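/- **Setting.** TF is the lambda-free logical framework given as follows. *Syntax.* An *arity* is a finite sequence $(\alpha_1,\dots,\alpha_n)$ of arities; the order of $()$ is $0$ and the order of $(\alpha_1,\dots,\alpha_n)$, $n>0$, is $1+\max_i \operatorname{order}(\alpha_i)$. Every variable and constant has an arity. An *object* is $z[F_1,\dots,F_n]$, where $z$ is a variable or constant of arity $(\alpha_1,\dots,\alpha_n)$ and $F_i$ is an $\alpha_i$-ary *abstraction*; an $(\alpha_1,\dots,\alpha_n)$-ary abstraction is $[x_1,\dots,x_n]M$ with $M$ an object and $x_i$ an $\alpha_i$-ary bound variable (everything is taken up to renaming of bound variables). *Instantiation* $\{F/x\}N$ is hereditary substitution: $\{F/x\}z[\vec G]=z[\{F/x\}\vec G]$ for $z\neq x$, and $\{F/x\}x[\vec G]=\{\{F/x\}\vec G/\vec t\,\}P$ if $F=[\vec t\,]P$. A *base kind* is $\mathbf{Type}$ or $\mathrm{El}(A)$ with $A$ an object; an $\alpha$-ary *kind* is $(\Delta)T$ with $T$ a base kind and $\Delta$ an $\alpha$-ary context; an $(\alpha_1,\dots,\alpha_n)$-ary *context* is $x_1:K_1,\dots,x_n:K_n$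 with $x_i$ distinct variables and $x_i$, $K_i$ of arity $\alpha_i$. The order of a kind or context is the order of its arity. *Judgements.* The primitive judgements are $\Gamma\ \mathrm{valid}$, $\Gamma\vdash M:T$ and $\Gamma\vdash M=N:T$, with $T$ a base kind. The following judgements stand for sets of primitive judgements. $\Gamma\Vdash(\Delta)\mathbf{Type}\ \mathrm{kind}$ is $\Gamma,\Delta\ \mathrm{valid}$, and $\Gamma\Vdash(\Delta)\mathrm{El}(A)\ \mathrm{kind}$ is $\Gamma,\Delta\vdash A:\mathbf{Type}$. $\Gamma\Vdash[\vec x]M:(\Delta)T$ is $\Gamma,\Delta\vdash M:T$, and $\Gamma\Vdash[\vec x]M=[\vec x]N:(\Delta)T$ is $\Gamma,\Delta\vdash M=N:T$, where $\vec x=\operatorname{dom}\Delta$. $\Gamma\Vdash\vec F::\Delta$, for $\Delta=x_1:K_1,\dots,x_n:K_n$, is $\Gamma\ \mathrm{valid}$ together with $\Gamma\Vdash F_i:\{F_1/x_1,\dots,F_{i-1}/x_{i-1}\}K_i$ for all $i$; likewise $\Gamma\Vdash\vec F=\vec G::\Delta$ is $\Gamma\ \mathrm{valid}$ together with $\Gamma\Vdash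 F_i=G_i:\{F_1/x_1,\dots,F_{i-1}/x_{i-1}\}K_i$ for all $i$. $\Gamma\Vdash\mathbf{Type}=\mathbf{Type}$ is $\Gamma\ \mathrm{valid}$; $\Gamma\Vdash\mathrm{El}(A)=\mathrm{El}(B)$ is $\Gamma\vdash A=B:\mathbf{Type}$; $\mathbf{Type}$ and $\mathrm{El}(A)$ are never equal; $\Gamma\Vdash(\Delta)T=(\Delta')T'$ is $\Gamma\Vdash\Delta=\Delta'$ together with $\Gamma,\Delta\Vdash T=T'$; $\Gamma\Vdash\langle\rangle=\langle\rangle$ is $\Gamma\ \mathrm{valid}$; and $\Gamma\Vdash(\Delta,x:K)=(\Delta',x:K')$ is $\Gamma\Vdash\Delta=\Delta'$ together with $\Gamma,\Delta\Vdash K=K'$. *Specifications.* A *specification* $\mathcal T$ is a set of *declarations*: constant declarations $c:(\Delta)T$, with $(\Delta)T$ a closed kind of the arity of $c$, and equation declarations $(\Delta)(M=N:T)$, with $\Delta$ a closed context, $M,N$ objects and $T$ a base kind over $\Delta$. The order of a declaration is the order of $\Delta$, and $o(\mathcal T)$ is the supremum of the orders of the declarations of $\mathcal T$. *Rules.* The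 empty context is valid; from $\Gamma\Vdash K\ \mathrm{kind}$ infer that $\Gamma,x:K$ is valid ($x\notin\operatorname{dom}\Gamma$). If $z:(\Delta)T$ is in $\Gamma$ or is a constant declaration of $\mathcal T$: from $\Gamma\Vdash\vec F::\Delta$ infer $\Gamma\vdash z\vec F:\{\vec F/\Delta\}T$, and from $\Gamma\Vdash\vec F=\vec G::\Delta$ infer $\Gamma\vdash z\vec F=z\vec G:\{\vec F/\Delta\}T$. If $(\Delta)(M=N:T)\in\mathcal T$: from $\Gamma\Vdash\vec F::\Delta$ infer $\Gamma\vdash\{\vec F/\Delta\}M=\{\vec F/\Delta\}N:\{\vec F/\Delta\}T$. Equality at a base kind is reflexive (on objects having that kind), symmetric and transitive. From $\Gamma\vdash A=B:\mathbf{Type}$ and $\Gamma\vdash M:\mathrm{El}(A)$ infer $\Gamma\vdash M:\mathrm{El}(B)$, and from $\Gamma\vdash A=B:\mathbf{Type}$ and $\Gamma\vdash M=N:\mathrm{El}(A)$ infer $\Gamma\vdash M=N:\mathrm{El}(B)$. **Definitions.** $\mathcal T$ is *orderable* if there is a well-ordering $\prec$ of its declarations such that, for every constant declaration $\delta=(c:(\Delta)T)$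 in $\mathcal T$, $\Delta\Vdash T\ \mathrm{kind}$ is derivable using only declarations $\delta'\prec\delta$, and, for every equation declaration $\delta=(\Delta)(M=N:T)$ in $\mathcal T$, $\Delta\vdash M:T$, $\Delta\vdash N:T$ and $\Delta\Vdash T\ \mathrm{kind}$ are derivable using only declarations $\delta'\prec\delta$. $\mathcal T$ is *$n$-good* if, whenever $\Gamma$ has order $\le n$ and $\Gamma\vdash M=N:T$ is derivable, both $\Gamma\vdash M:T$ and $\Gamma\vdash N:T$ are derivable. $\mathcal T$ is *good* if it is $n$-good for every natural number $n$. **Theorem.** Let $\mathcal T$ be a specification in TF. 1. If $\mathcal T$ contains no equation declarations, then $\mathcal T$ is good. 2. Suppose $\mathcal T$ is orderable and $o(\mathcal T)\le 2$. Then $\mathcal T$ is $2$-good. Moreover, whenever $\Gamma,x:K,\Delta$ is a context of order $\le 2$ (with $J$ the body of a primitive judgement, and derivability meant throughout): (Cut) if $\Gamma,x:K,\Delta\vdash J$ and $\Gamma\Vdash F:K$, then $\Gamma,\{F/x\}\Delta\vdash\{F/x\}J$; (Functionality) if $\Gamma,x:K,\Delta\vdash M:T$ and $\Gamma\Vdash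 F=G:K$, then $\Gamma,\{F/x\}\Delta\vdash\{F/x\}M=\{G/x\}M:\{F/x\}T$; (Context Conversion) if $\Gamma,x:K,\Delta\vdash J$ and $\Gamma\Vdash K=K'$, then $\Gamma,x:K',\Delta\vdash J$. -/

import Mathlib

namespace TF

universe u

/-! ### Arities -/

/-- An arity is a finite sequence `(α₁, …, αₙ)` of arities.  `nil` is the base arity `()` and
`snoc α a` is the sequence `α` followed by the arity `a`.  Since a context or a list of bound
variables is determined, up to renaming of variables, by the arities of its variables, arities
also serve as the scopes (de Bruijn style) of all expressions. -/
inductive Arity : Type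
  | nil : Arity
  | snoc (α : Arity) (a : Arity) : Arity

/-- Concatenation of arities. -/
@[reducible] def Arity.append (g : Arity) : Arity → Arity
  | .nil => g
  | .snoc α a => .snoc (Arity.append g α) a

infixl:65 " ⧺ " => Arity.append

/-- The order of an arity: `()` has order `0`, and `(α₁, …, αₙ)` with `n > 0` has order
`1 + max (order αᵢ)`. -/
def Arity.order : Arity → ℕ
  | .nil => 0
  | .snoc α a => max α.order (a.order + 1)

/-- `Var g a` is the type of the `a`-ary variables in scope `g`, that is, of the positions in the
sequence `g` at which the arity `a` stands. -/
inductive Var : Arity → Arity → Type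
  | last {g a : Arity} : Var (.snoc g a) a
  | prev {g a b : Arity} (x : Var g a) : Var (.snoc g b) a

/-- A variable of `g`, seen as a variable of `g ⧺ α`. -/
def Var.inl {g c : Arity} (x : Var g c) : (α : Arity) → Var (g ⧺ α) c
  | .nil => x
  | .snoc α _ => .prev (Var.inl x α)

/-- A variable of `α`, seen as a variable of `g ⧺ α`. -/
def Var.inr (g : Arity) {c : Arity} : {α : Arity} → Var α c → Var (g ⧺ α) c
  | _, .last => .last
  | _, .prev x => .prev (Var.inr g x)

/-- A variable of `g ⧺ α` comes either from `g` or from `α`. -/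
def Var.split {g c : Arity} : (α : Arity) → Var (g ⧺ α) c → Var g c ⊕ Var α c
  | .nil, x => .inl x
  | .snoc _ _, .last => .inr .last
  | .snoc α _, .prev x =>
    match Var.split α x with
    | .inl y => .inl y
    | .inr v => .inr (.prev v)

theorem Var.split_inl {g c : Arity} (x : Var g c) (α : Arity) :
    Var.split α (Var.inl x α) = .inl x := by
  induction α with
  | nil => rfl
  | snoc α a ih => simp [Var.inl, Var.split, ih]

theorem Var.split_inr (g : Arity) {c α : Arity} (v : Var α c) :
    Var.split α (Var.inr g v) = .inr v := by
  induction v with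
  | last => rfl
  | prev v ih => simp [Var.inr, Var.split, ih]

/-! ### Objects, abstractions and renaming -/

/-- The objects in scope `g` over the constants `C` (`C α` is the type of `α`-ary constants).
An object is an `α`-ary variable or constant followed by an abstraction for every position of `α`;
the abstraction at a position of arity `β` is an object in which a sequence of variables
of arity `β` is bound. -/
inductive Obj (C : Arity → Type u) : Arity → Type u
  | var {g α : Arity} (x : Var g α) (F : ∀ β : Arity, Var α β → Obj C (g ⧺ β)) : Obj C g
  | const {g α : Arity} (c : C α) (F : ∀ β : Arity, Var α β → Obj C (g ⧺ β)) : Obj C g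

/-- An `α`-ary abstraction `[x₁, …, xₙ]M` in scope `g`, given by its body `M`. -/
abbrev Abs (C : Arity → Type u) (g α : Arity) : Type u := Obj C (g ⧺ α)

/-- An `α`-ary abstraction sequence `⟨F₁, …, Fₙ⟩` in scope `g`. -/
abbrev AbsSeq (C : Arity → Type u) (g α : Arity) : Type u :=
  ∀ β : Arity, Var α β → Abs C g β

/-- Renamings of the variables of `g` by variables of `h` of the same arity. -/
abbrev Ren (g h : Arity) : Type := ∀ c : Arity, Var g c → Var h c

/-- A renaming under a block of bound variables of arity `α`. -/
def Ren.lift {g h : Arity} (ρ : Ren g h) (α : Arity) : Ren (g ⧺ α) (h ⧺ α) := fun c x =>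
  match Var.split α x with
  | .inl y => Var.inl (ρ c y) α
  | .inr v => Var.inr h v

/-- Weakening by a block of variables. -/
def Ren.wk (g α : Arity) : Ren g (g ⧺ α) := fun _ x => Var.inl x α

/-- The renaming of the empty scope into any scope. -/
def Ren.ofNil (g : Arity) : Ren .nil g := fun _ x => nomatch x

variable {C : Arity → Type u}

def Obj.rename : {g : Arity} → Obj C g → (h : Arity) → Ren g h → Obj C h
  | _, .var x F, h, ρ => .var (ρ _ x) (fun β v => (F β v).rename (h ⧺ β) (ρ.lift β))
  | _, .const c F, h, ρ => .const c (fun β v => (F β v).rename (h ⧺ β) (ρ.lift β))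

def Abs.rename {g h α : Arity} (F : Abs C g α) (ρ : Ren g h) : Abs C h α :=
  Obj.rename F (h ⧺ α) (ρ.lift α)

/-! ### Instantiation and employment -/

/-- A (simultaneous) substitution: every variable of `g` is either kept, as a variable of `h`, or
is to be instantiated by an abstraction in scope `h` of the same arity. -/
abbrev Sub (C : Arity → Type u) (g h : Arity) : Type u :=
  ∀ c : Arity, Var g c → Var h c ⊕ Abs C h c

/-- A substitution under a block of bound variables of arity `α`, which are kept. -/
def Sub.lift {g h : Arity} (σ : Sub C g h) (α : Arity) : Sub C (g ⧺ α) (h ⧺ α) := fun c x =>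
  match Var.split α x with
  | .inl y =>
    match σ c y with
    | .inl z => .inl (Var.inl z α)
    | .inr F => .inr (F.rename (Ren.wk h α))
  | .inr v => .inl (Var.inr h v)

/-- The substitution `{F / x}` of an abstraction for the last variable of a scope. -/
def Sub.single {g a : Arity} (F : Abs C g a) : Sub C (.snoc g a) g := fun _ x =>
  match x with
  | .last => .inr F
  | .prev y => .inl y

/-- The substitution `{F₁ / x₁, …, Fₙ / xₙ}` of an abstraction sequence for the last block of
variables of a scope. -/
def Sub.block {g α : Arity} (F : AbsSeq C g α) : Sub C (g ⧺ α) g := fun c x =>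
  match Var.split α x with
  | .inl y => .inl y
  | .inr v => .inr (F c v)

/-- The type of an operation taking an `α`-ary abstraction `F` and an `α`-ary abstraction
sequence `G₁, …, Gₙ` to an object `F • G₁ • ⋯ • Gₙ`. -/
abbrev Emp (C : Arity → Type u) (α : Arity) : Type u :=
  ∀ g : Arity, Abs C g α → AbsSeq C g α → Obj C g

/-- A substitution which comes, for every abstraction in it, with an employment operation at the
arity of that abstraction. -/
abbrev EmpSub (C : Arity → Type u) (g h : Arity) : Type u :=
  ∀ c : Arity, Var g c → Var h c ⊕ (Abs C h c × Emp C c)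

def EmpSub.lift {g h : Arity} (σ : EmpSub C g h) (α : Arity) : EmpSub C (g ⧺ α) (h ⧺ α) :=
  fun c x =>
  match Var.split α x with
  | .inl y =>
    match σ c y with
    | .inl z => .inl (Var.inl z α)
    | .inr (F, e) => .inr (F.rename (Ren.wk h α), e)
  | .inr v => .inl (Var.inr h v)

/-- The recursion on objects in the definition of instantiation, given the employment
operations for the abstractions that are substituted. -/
def Obj.instWith : {g : Arity} → Obj C g → (h : Arity) → EmpSub C g h → Obj C h
  | _, .const c F, h, σ => .const c (fun β v => (F β v).instWith (h ⧺ β) (σ.lift β))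
  | _, .var x F, h, σ =>
    match σ _ x with
    | .inl y => .var y (fun β v => (F β v).instWith (h ⧺ β) (σ.lift β))
    | .inr (P, e) => e h P (fun β v => (F β v).instWith (h ⧺ β) (σ.lift β))

/-- Employment at arity `α`, given the employment operations for the entries of `α`. -/
def employWith (α : Arity) (E : ∀ c : Arity, Var α c → Emp C c) : Emp C α := fun g P G =>
  Obj.instWith P g (fun c x =>
    match Var.split α x with
    | .inl y => .inl y
    | .inr v => .inr (G c v, E c v))

/-- The recursion on arities in the definition of employment. -/
def employs : (α : Arity) → ∀ c : Arity, Var α c → Emp C c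
  | .snoc _ a, _, .last => employWith a (employs a)
  | .snoc α _, c, .prev v => employs α c v

/-- Employment: `employ α g F G` is `F • G₁ • ⋯ • Gₙ`, in scope `g`. -/
def employ (α : Arity) : Emp C α := employWith α (employs α)

/-- A substitution, with employment attached to each of its abstractions. -/
def Sub.withEmp {g h : Arity} (σ : Sub C g h) : EmpSub C g h := fun c x =>
  match σ c x with
  | .inl y => .inl y
  | .inr F => .inr (F, employ c)

/-- Instantiation (hereditary substitution): the result of simultaneously instantiating
abstractions for variables in an object, as prescribed by `σ`. -/
def Obj.inst {g h : Arity} (σ : Sub C g h) (M : Obj C g) : Obj C h :=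
  M.instWith h σ.withEmp

/-! The defining equations of instantiation and employment. -/

theorem employs_eq {α c : Arity} (v : Var α c) :
    (employs α c v : Emp C c) = employ c := by
  induction v with
  | last => rfl
  | prev v ih => exact ih

theorem Sub.withEmp_lift {g h : Arity} (σ : Sub C g h) (β : Arity) :
    σ.withEmp.lift β = (σ.lift β).withEmp := by
  funext c x
  simp only [EmpSub.lift, Sub.lift, Sub.withEmp]
  cases Var.split β x with
  | inl y => simp only []; cases σ c y <;> rfl
  | inr v => rfl

/-- `{σ} c[G₁, …, Gₙ] = c[{σ}G₁, …, {σ}Gₙ]`. -/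
theorem Obj.inst_const {g h α : Arity} (σ : Sub C g h) (c : C α) (G : AbsSeq C g α) :
    Obj.inst σ (.const c G) = .const c (fun β v => Obj.inst (σ.lift β) (G β v)) := by
  simp only [Obj.inst, Obj.instWith, Sub.withEmp_lift]

/-- `{σ} x[G₁, …, Gₙ] = y[{σ}G₁, …, {σ}Gₙ]` if `σ` keeps `x`, as the variable `y`. -/
theorem Obj.inst_var_inl {g h α : Arity} (σ : Sub C g h) (x : Var g α) (G : AbsSeq C g α)
    (y : Var h α) (hx : σ α x = .inl y) :
    Obj.inst σ (.var x G) = .var y (fun β v => Obj.inst (σ.lift β) (G β v)) := by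
  have h1 : σ.withEmp α x = .inl y := by simp only [Sub.withEmp, hx]
  simp only [Obj.inst, Obj.instWith, Sub.withEmp_lift, h1]

/-- `{σ} x[G₁, …, Gₙ] = F • {σ}G₁ • ⋯ • {σ}Gₙ` if `σ` instantiates `F` for `x`. -/
theorem Obj.inst_var_inr {g h α : Arity} (σ : Sub C g h) (x : Var g α) (G : AbsSeq C g α)
    (F : Abs C h α) (hx : σ α x = .inr F) :
    Obj.inst σ (.var x G) = employ α h F (fun β v => Obj.inst (σ.lift β) (G β v)) := by
  have h1 : σ.withEmp α x = .inr (F, employ α) := by simp only [Sub.withEmp, hx]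
  simp only [Obj.inst, Obj.instWith, Sub.withEmp_lift, h1]

/-- `([t₁, …, tₙ]P) • G₁ • ⋯ • Gₙ = {G₁ / t₁, …, Gₙ / tₙ}P`. -/
theorem employ_eq {g α : Arity} (P : Abs C g α) (G : AbsSeq C g α) :
    employ α g P G = Obj.inst (Sub.block G) P := by
  unfold employ employWith Obj.inst
  congr 1
  funext c x
  simp only [Sub.withEmp, Sub.block]
  cases Var.split α x with
  | inl y => rfl
  | inr v => simp only [employs_eq]

/-! ### Kinds and contexts -/

/-- A base kind in scope `g`: the symbol `Type`, or `El A` for an object `A`. -/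
inductive BaseKind (C : Arity → Type u) (g : Arity) : Type u
  | type : BaseKind C g
  | el (A : Obj C g) : BaseKind C g

/-- `Tele C g α` is the type of the `α`-ary contexts `x₁ : K₁, …, xₙ : Kₙ` over the scope `g`,
whose kinds may mention the variables of `g`.  In `snoc Δ Θ T` the context `Δ` is extended by
a variable of the product kind `(Θ)T`. -/
inductive Tele (C : Arity → Type u) : Arity → Arity → Type u
  | nil {g : Arity} : Tele C g .nil
  | snoc {g α a : Arity} (Δ : Tele C g α) (Θ : Tele C (g ⧺ α) a)
      (T : BaseKind C (g ⧺ α ⧺ a)) : Tele C g (.snoc α a)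

/-- An `a`-ary product kind `(Θ)T` in scope `g`. -/
structure Kind (C : Arity → Type u) (g a : Arity) : Type u where
  tele : Tele C g a
  base : BaseKind C (g ⧺ a)

/-- Contexts of arity `g`. -/
inductive Ctx (C : Arity → Type u) : Arity → Type u
  | nil : Ctx C .nil
  | snoc {g a : Arity} (Γ : Ctx C g) (K : Kind C g a) : Ctx C (.snoc g a)

/-- The context `Γ, Δ`. -/
def Ctx.append {g : Arity} (Γ : Ctx C g) : {α : Arity} → Tele C g α → Ctx C (g ⧺ α)
  | _, .nil => Γ
  | _, .snoc Δ Θ T => .snoc (Γ.append Δ) ⟨Θ, T⟩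

def BaseKind.rename {g h : Arity} (ρ : Ren g h) : BaseKind C g → BaseKind C h
  | .type => .type
  | .el A => .el (A.rename h ρ)

def Tele.rename : {g α : Arity} → Tele C g α → (h : Arity) → Ren g h → Tele C h α
  | _, _, .nil, _, _ => .nil
  | _, _, .snoc (α := α) (a := a) Δ Θ T, h, ρ =>
    .snoc (Δ.rename h ρ) (Θ.rename (h ⧺ α) (ρ.lift α)) (T.rename ((ρ.lift α).lift a))

def Kind.rename {g h a : Arity} (ρ : Ren g h) (K : Kind C g a) : Kind C h a :=
  ⟨K.tele.rename h ρ, K.base.rename (ρ.lift a)⟩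

def BaseKind.inst {g h : Arity} (σ : Sub C g h) : BaseKind C g → BaseKind C h
  | .type => .type
  | .el A => .el (A.inst σ)

def Tele.inst : {g α : Arity} → {h : Arity} → Sub C g h → Tele C g α → Tele C h α
  | _, _, _, _, .nil => .nil
  | _, _, _, σ, .snoc (α := α) (a := a) Δ Θ T =>
    .snoc (Δ.inst σ) (Θ.inst (σ.lift α)) (T.inst ((σ.lift α).lift a))

def Kind.inst {g h a : Arity} (σ : Sub C g h) (K : Kind C g a) : Kind C h a :=
  ⟨K.tele.inst σ, K.base.inst (σ.lift a)⟩

/-- The kind of a variable declared in a context, weakened to the whole context. -/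
def Ctx.lookup : {g : Arity} → Ctx C g → {a : Arity} → Var g a → Kind C g a
  | _, .snoc _ K, _, .last => K.rename (fun _ y => .prev y)
  | _, .snoc Γ _, _, .prev x => (Γ.lookup x).rename (fun _ y => .prev y)

/-! ### Judgements -/

/-- The body of a primitive judgement in scope `g`: `valid`, `M : T` or `M = N : T`. -/
inductive Body (C : Arity → Type u) (g : Arity) : Type u
  | valid : Body C g
  | hasKind (M : Obj C g) (T : BaseKind C g) : Body C g
  | eq (M N : Obj C g) (T : BaseKind C g) : Body C g

def Body.inst {g h : Arity} (σ : Sub C g h) : Body C g → Body C h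
  | .valid => .valid
  | .hasKind M T => .hasKind (M.inst σ) (T.inst σ)
  | .eq M N T => .eq (M.inst σ) (N.inst σ) (T.inst σ)

/-- A primitive judgement: a context together with a judgement body. -/
structure Judgement (C : Arity → Type u) : Type u where
  {arity : Arity}
  ctx : Ctx C arity
  body : Body C arity

/-- The judgement `Γ ⊩ T kind` for a base kind `T`. -/
def baseKindJ {g : Arity} (Γ : Ctx C g) : BaseKind C g → Judgement C
  | .type => ⟨Γ, .valid⟩
  | .el A => ⟨Γ, .hasKind A .type⟩

/-- The judgement `Γ ⊩ (Δ)T kind`. -/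
def kindJ {g a : Arity} (Γ : Ctx C g) (K : Kind C g a) : Judgement C :=
  baseKindJ (Γ.append K.tele) K.base

/-- The judgement `Γ ⊩ F : K`, which is `Γ, Δ ⊢ M : T` for `F = [dom Δ]M`, `K = (Δ)T`. -/
def absJ {g a : Arity} (Γ : Ctx C g) (F : Abs C g a) (K : Kind C g a) : Judgement C :=
  ⟨Γ.append K.tele, .hasKind F K.base⟩

/-- The judgement `Γ ⊩ F = G : K`, which is `Γ, Δ ⊢ M = N : T` for `F = [dom Δ]M`,
`G = [dom Δ]N`, `K = (Δ)T`. -/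
def absEqJ {g a : Arity} (Γ : Ctx C g) (F G : Abs C g a) (K : Kind C g a) : Judgement C :=
  ⟨Γ.append K.tele, .eq F G K.base⟩

/-- All entries of an abstraction sequence but the last. -/
def AbsSeq.init {g α a : Arity} (F : AbsSeq C g (.snoc α a)) : AbsSeq C g α :=
  fun β v => F β (.prev v)

/-- The last entry of an abstraction sequence. -/
def AbsSeq.final {g α a : Arity} (F : AbsSeq C g (.snoc α a)) : Abs C g a := F a .last

/-- The set of primitive judgements `Γ ⊩ F⃗ :: Δ`. -/
def satJ {g : Arity} (Γ : Ctx C g) :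
    {α : Arity} → AbsSeq C g α → Tele C g α → Set (Judgement C)
  | _, _, .nil => {⟨Γ, .valid⟩}
  | _, F, .snoc Δ Θ T =>
    satJ Γ F.init Δ ∪ {absJ Γ F.final (Kind.inst (Sub.block F.init) ⟨Θ, T⟩)}

/-- The set of primitive judgements `Γ ⊩ F⃗ = G⃗ :: Δ`. -/
def satEqJ {g : Arity} (Γ : Ctx C g) :
    {α : Arity} → AbsSeq C g α → AbsSeq C g α → Tele C g α → Set (Judgement C)
  | _, _, _, .nil => {⟨Γ, .valid⟩}
  | _, F, G, .snoc Δ Θ T =>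
    satEqJ Γ F.init G.init Δ ∪
      {absEqJ Γ F.final G.final (Kind.inst (Sub.block F.init) ⟨Θ, T⟩)}

/-! ### Specifications and derivability -/

/-- A declaration: a constant declaration `c : K`, with `K` a closed kind of the arity of `c`, or
an equation declaration `(Δ)(M = N : T)`. -/
inductive Decl (C : Arity → Type u) : Type u
  | const {α : Arity} (c : C α) (K : Kind C .nil α) : Decl C
  | eqn {α : Arity} (Δ : Tele C .nil α) (M N : Obj C (.nil ⧺ α)) (T : BaseKind C (.nil ⧺ α)) :
      Decl C

def Decl.IsEquation : Decl C → Prop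
  | .const _ _ => False
  | .eqn _ _ _ _ => True

/-- The order of a declaration. -/
def Decl.order : Decl C → ℕ
  | .const (α := α) _ _ => α.order
  | .eqn (α := α) _ _ _ _ => α.order

/-- A type theory specification is a set of declarations. -/
abbrev Spec (C : Arity → Type u) : Type u := Set (Decl C)

/-- The order of a specification, `⊤` if the orders of its declarations are unbounded. -/
noncomputable def Spec.order (S : Spec C) : ℕ∞ := ⨆ δ ∈ S, (δ.order : ℕ∞)

/-- `Derivable S Γ J`: the primitive judgement with context `Γ` and body `J` is derivable in TF
under the specification `S`. -/
inductive Derivable (S : Spec C) : {g : Arity} → Ctx C g → Body C g → Prop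
  | emp_ctxt : Derivable S .nil .valid
  | ctxt {g a : Arity} {Γ : Ctx C g} {K : Kind C g a} :
      Derivable S (kindJ Γ K).ctx (kindJ Γ K).body → Derivable S (Γ.snoc K) .valid
  | var {g α : Arity} {Γ : Ctx C g} (x : Var g α) (F : AbsSeq C g α) :
      (∀ J ∈ satJ Γ F (Γ.lookup x).tele, Derivable S J.ctx J.body) →
      Derivable S Γ (.hasKind (.var x F) ((Γ.lookup x).base.inst (Sub.block F)))
  | var_eq {g α : Arity} {Γ : Ctx C g} (x : Var g α) (F G : AbsSeq C g α) :
      (∀ J ∈ satEqJ Γ F G (Γ.lookup x).tele, Derivable S J.ctx J.body) →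
      Derivable S Γ (.eq (.var x F) (.var x G) ((Γ.lookup x).base.inst (Sub.block F)))
  | ref {g : Arity} {Γ : Ctx C g} {M : Obj C g} {T : BaseKind C g} :
      Derivable S Γ (.hasKind M T) → Derivable S Γ (.eq M M T)
  | sym {g : Arity} {Γ : Ctx C g} {M N : Obj C g} {T : BaseKind C g} :
      Derivable S Γ (.eq M N T) → Derivable S Γ (.eq N M T)
  | trans {g : Arity} {Γ : Ctx C g} {M N P : Obj C g} {T : BaseKind C g} :
      Derivable S Γ (.eq M N T) → Derivable S Γ (.eq N P T) → Derivable S Γ (.eq M P T)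
  | conv {g : Arity} {Γ : Ctx C g} {M A B : Obj C g} :
      Derivable S Γ (.hasKind M (.el A)) → Derivable S Γ (.eq A B .type) →
      Derivable S Γ (.hasKind M (.el B))
  | conv_eq {g : Arity} {Γ : Ctx C g} {M N A B : Obj C g} :
      Derivable S Γ (.eq M N (.el A)) → Derivable S Γ (.eq A B .type) →
      Derivable S Γ (.eq M N (.el B))
  | const {g α : Arity} {Γ : Ctx C g} {c : C α} {K : Kind C .nil α} (hc : Decl.const c K ∈ S)
      (F : AbsSeq C g α) :
      (∀ J ∈ satJ Γ F (K.rename (Ren.ofNil g)).tele, Derivable S J.ctx J.body) →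
      Derivable S Γ
        (.hasKind (.const c F) ((K.rename (Ren.ofNil g)).base.inst (Sub.block F)))
  | const_eq {g α : Arity} {Γ : Ctx C g} {c : C α} {K : Kind C .nil α}
      (hc : Decl.const c K ∈ S) (F G : AbsSeq C g α) :
      (∀ J ∈ satEqJ Γ F G (K.rename (Ren.ofNil g)).tele, Derivable S J.ctx J.body) →
      Derivable S Γ
        (.eq (.const c F) (.const c G) ((K.rename (Ren.ofNil g)).base.inst (Sub.block F)))
  | eq {g α : Arity} {Γ : Ctx C g} {Δ : Tele C .nil α} {M N : Obj C (.nil ⧺ α)}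
      {T : BaseKind C (.nil ⧺ α)} (he : Decl.eqn Δ M N T ∈ S) (F : AbsSeq C g α) :
      (∀ J ∈ satJ Γ F (Δ.rename g (Ren.ofNil g)), Derivable S J.ctx J.body) →
      Derivable S Γ
        (.eq (Obj.inst (Sub.block F) (M.rename (g ⧺ α) ((Ren.ofNil g).lift α)))
          (Obj.inst (Sub.block F) (N.rename (g ⧺ α) ((Ren.ofNil g).lift α)))
          (BaseKind.inst (Sub.block F) (T.rename ((Ren.ofNil g).lift α))))

/-- Derivability of a judgement. -/
def Derives (S : Spec C) (J : Judgement C) : Prop := Derivable S J.ctx J.body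

/-- Derivability of `Γ ⊩ T = T'` for base kinds; this is undefined, hence not derivable,
if exactly one of `T`, `T'` is `Type`. -/
def BaseKindEq (S : Spec C) {g : Arity} (Γ : Ctx C g) : BaseKind C g → BaseKind C g → Prop
  | .type, .type => Derivable S Γ .valid
  | .el A, .el B => Derivable S Γ (.eq A B .type)
  | _, _ => False

/-- Derivability of `Γ ⊩ Δ = Δ'`. -/
def TeleEq (S : Spec C) : {g α : Arity} → Ctx C g → Tele C g α → Tele C g α → Prop
  | _, _, Γ, .nil, .nil => Derivable S Γ .valid
  | _, _, Γ, .snoc Δ Θ T, .snoc Δ' Θ' T' =>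
    TeleEq S Γ Δ Δ' ∧
      (TeleEq S (Γ.append Δ) Θ Θ' ∧ BaseKindEq S ((Γ.append Δ).append Θ) T T')

/-- Derivability of `Γ ⊩ K = K'`, that is, of `Γ ⊩ Δ = Δ'` and `Γ, Δ ⊩ T = T'` for
`K = (Δ)T` and `K' = (Δ')T'`. -/
def KindEq (S : Spec C) {g a : Arity} (Γ : Ctx C g) (K K' : Kind C g a) : Prop :=
  TeleEq S Γ K.tele K'.tele ∧ BaseKindEq S (Γ.append K.tele) K.base K'.base

/-! ### Orderable and good specifications -/

/-- The condition that orderability imposes on a declaration, `S` being the set of the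
declarations that precede it. -/
def Decl.WellFormed (S : Spec C) : Decl C → Prop
  | .const _ K => Derives S (baseKindJ (Ctx.nil.append K.tele) K.base)
  | .eqn Δ M N T =>
    Derivable S (Ctx.nil.append Δ) (.hasKind M T) ∧
    Derivable S (Ctx.nil.append Δ) (.hasKind N T) ∧
    Derives S (baseKindJ (Ctx.nil.append Δ) T)

/-- `S` is orderable: its declarations can be well-ordered so that each is well-formed
using only the declarations that precede it. -/
def Orderable (S : Spec C) : Prop :=
  ∃ r : S → S → Prop, IsWellOrder S r ∧
    ∀ δ : S, (δ : Decl C).WellFormed {d | ∃ hd : d ∈ S, r ⟨d, hd⟩ δ}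

/-- `S` is `n`-good: in contexts of order at most `n`, both sides of every derivable equation
have the kind at which the equation is derivable. -/
def NGood (n : ℕ) (S : Spec C) : Prop :=
  ∀ {g : Arity} (Γ : Ctx C g), g.order ≤ n → ∀ (M N : Obj C g) (T : BaseKind C g),
    Derivable S Γ (.eq M N T) → Derivable S Γ (.hasKind M T) ∧ Derivable S Γ (.hasKind N T)

def Good (S : Spec C) : Prop := ∀ n : ℕ, NGood n S

/-- Cut, for contexts `Γ, x : K, Δ` of order at most `n`. -/
def Cut (n : ℕ) (S : Spec C) : Prop :=
  ∀ {g a d : Arity} (Γ : Ctx C g) (K : Kind C g a) (Δ : Tele C (.snoc g a) d)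
    (J : Body C (.snoc g a ⧺ d)) (F : Abs C g a),
    (Arity.snoc g a ⧺ d).order ≤ n →
    Derivable S ((Γ.snoc K).append Δ) J →
    Derives S (absJ Γ F K) →
    Derivable S (Γ.append (Δ.inst (Sub.single F))) (J.inst ((Sub.single F).lift d))

/-- Functionality, for contexts `Γ, x : K, Δ` of order at most `n`. -/
def Functionality (n : ℕ) (S : Spec C) : Prop :=
  ∀ {g a d : Arity} (Γ : Ctx C g) (K : Kind C g a) (Δ : Tele C (.snoc g a) d)
    (M : Obj C (.snoc g a ⧺ d)) (T : BaseKind C (.snoc g a ⧺ d)) (F G : Abs C g a),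
    (Arity.snoc g a ⧺ d).order ≤ n →
    Derivable S ((Γ.snoc K).append Δ) (.hasKind M T) →
    Derives S (absEqJ Γ F G K) →
    Derivable S (Γ.append (Δ.inst (Sub.single F)))
      (.eq (M.inst ((Sub.single F).lift d)) (M.inst ((Sub.single G).lift d))
        (T.inst ((Sub.single F).lift d)))

/-- Context Conversion, for contexts `Γ, x : K, Δ` of order at most `n`. -/
def ContextConversion (n : ℕ) (S : Spec C) : Prop :=
  ∀ {g a d : Arity} (Γ : Ctx C g) (K K' : Kind C g a) (Δ : Tele C (.snoc g a) d)
    (J : Body C (.snoc g a ⧺ d)),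
    (Arity.snoc g a ⧺ d).order ≤ n →
    Derivable S ((Γ.snoc K).append Δ) J →
    KindEq S Γ K K' →
    Derivable S ((Γ.snoc K').append Δ) J

end TF

/-!
Without equation declarations every derivable equation is a syntactic identity
(`Derivable.syntacticEq`): only declared equations could identify two different objects, so
the sides of an equation inherit its kind.

For an orderable specification, the difficulty is that goodness, Cut and Functionality depend on
each other: the right-hand side of `z[F⃗] = z[G⃗] : {F⃗}T` has the kind `{G⃗}T`, which has to be
converted to `{F⃗}T` by Functionality, while Functionality at a conversion step needs Cut for both
of the substituted abstractions.  All of them are obtained at once from a Kripke logical relation.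

* The worlds are the valid contexts, with kind-preserving renamings as morphisms (`Mor`).  At a
  base kind, two objects are related if in all later worlds both have the kind and they are equal at
  it (`BaseRel`); abstractions are related if they send related arguments to related results.  The
  relation is defined by recursion on the arity (`SeqRel`, `TeleRel`), and it is a partial
  equivalence that respects conversion (`TelePER.all`).  Quantifying over later worlds makes a
  separate proof of weakening unnecessary.
* By induction on the arity, variables are related to themselves, and related abstractions are
  derivably of their kind and equal at it (`Escape.all`).
* The fundamental theorem `Derivable.sem`: a derivable judgement sends related environments to
  related things.  The declarations that occur in the derivation have to be semantically valid,
  which for an orderable specification follows by well-founded induction (`Orderable.semDecl`).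

As the identity is an environment related to itself (`SemCtx.valid_and_id`), goodness follows.  Cut,
Functionality and Context Conversion are the instances of the fundamental theorem at the
environments `{F/x}` and `{F/x}`, `{F/x}` and `{G/x}`, and the identity from `Γ, x : K'` to
`Γ, x : K`, lifted along `Δ` (`EnvRel.lift`).

The syntactic basis is the composition law of hereditary substitution (`Obj.inst_inst`), proved by
induction on the orders of the arities involved, and the fact that replacing variables by their long
forms does not affect instantiation (`inst_eta`, `Obj.inst_congr`).
-/

namespace TF

universe u

variable {C : Arity → Type u}

/-! ### Variables, renamings and substitutions -/

theorem Var.order_lt {α β : Arity} (v : Var α β) : β.order < α.order := by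
  induction v with
  | last => simp only [Arity.order]; omega
  | prev v ih => simp only [Arity.order]; omega

theorem Var.inl_or_inr {g c : Arity} (α : Arity) (x : Var (g ⧺ α) c) :
    (∃ y : Var g c, x = Var.inl y α) ∨ ∃ v : Var α c, x = Var.inr g v := by
  induction α with
  | nil => exact .inl ⟨x, rfl⟩
  | snoc α a ih =>
    cases x with
    | last => exact .inr ⟨.last, rfl⟩
    | prev x =>
      rcases ih x with ⟨y, rfl⟩ | ⟨v, rfl⟩
      · exact .inl ⟨y, rfl⟩
      · exact .inr ⟨.prev v, rfl⟩

/-- Families indexed by the variables of `g ⧺ α` are equal if they agree on `g` and on `α`. -/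
theorem funext_append {g α : Arity} {P : Arity → Type u} {σ τ : ∀ c, Var (g ⧺ α) c → P c}
    (hl : ∀ c (y : Var g c), σ c (Var.inl y α) = τ c (Var.inl y α))
    (hr : ∀ c (v : Var α c), σ c (Var.inr g v) = τ c (Var.inr g v)) : σ = τ := by
  funext c x
  rcases Var.inl_or_inr α x with ⟨y, rfl⟩ | ⟨v, rfl⟩
  · exact hl c y
  · exact hr c v

@[simp] theorem Ren.lift_inl {g h c : Arity} (ρ : Ren g h) (α : Arity) (y : Var g c) :
    ρ.lift α c (Var.inl y α) = Var.inl (ρ c y) α := by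
  simp [Ren.lift, Var.split_inl]

@[simp] theorem Ren.lift_inr {g h c α : Arity} (ρ : Ren g h) (v : Var α c) :
    ρ.lift α c (Var.inr g v) = Var.inr h v := by
  simp [Ren.lift, Var.split_inr]

/-- The value of a substitution at a variable (a variable if it is kept, otherwise the abstraction
instantiated for it), weakened by a block of variables. -/
def weakenVal {h c : Arity} (α : Arity) : Var h c ⊕ Abs C h c → Var (h ⧺ α) c ⊕ Abs C (h ⧺ α) c
  | .inl z => .inl (Var.inl z α)
  | .inr F => .inr (F.rename (Ren.wk h α))

@[simp] theorem Sub.lift_inl {g h c : Arity} (σ : Sub C g h) (α : Arity) (y : Var g c) :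
    σ.lift α c (Var.inl y α) = weakenVal α (σ c y) := by
  simp only [Sub.lift, Var.split_inl]
  cases σ c y <;> rfl

@[simp] theorem Sub.lift_inr {g h c α : Arity} (σ : Sub C g h) (v : Var α c) :
    σ.lift α c (Var.inr g v) = .inl (Var.inr h v) := by
  simp [Sub.lift, Var.split_inr]

/-- A renaming, as a substitution that keeps every variable. -/
def Sub.ofRen {g h : Arity} (ρ : Ren g h) : Sub C g h := fun c x => .inl (ρ c x)

/-- The identity substitution. -/
def Sub.id (g : Arity) : Sub C g g := fun _ x => .inl x

/-- The extension of a substitution by an abstraction sequence for a block of variables. -/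
def Sub.cons {g h α : Arity} (σ : Sub C g h) (H : AbsSeq C h α) : Sub C (g ⧺ α) h := fun c x =>
  match Var.split α x with
  | .inl y => σ c y
  | .inr v => .inr (H c v)

@[simp] theorem Sub.cons_inl {g h α c : Arity} (σ : Sub C g h) (H : AbsSeq C h α) (y : Var g c) :
    σ.cons H c (Var.inl y α) = σ c y := by
  simp [Sub.cons, Var.split_inl]

@[simp] theorem Sub.cons_inr {g h α c : Arity} (σ : Sub C g h) (H : AbsSeq C h α) (v : Var α c) :
    σ.cons H c (Var.inr g v) = .inr (H c v) := by
  simp [Sub.cons, Var.split_inr]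

theorem Sub.block_eq_cons {g α : Arity} (H : AbsSeq C g α) :
    Sub.block H = (Sub.id g).cons H := rfl

/-- Post-composition of a substitution with a renaming. -/
def Sub.thenRen {g h k : Arity} (σ : Sub C g h) (ρ : Ren h k) : Sub C g k := fun c x =>
  match σ c x with
  | .inl y => .inl (ρ c y)
  | .inr F => .inr (F.rename ρ)

/-- Pre-composition of a substitution with a renaming. -/
def Sub.afterRen {g h k : Arity} (ρ : Ren g h) (σ : Sub C h k) : Sub C g k := fun c x => σ c (ρ c x)

/-- The composite substitution: first `σ`, then `τ`. -/
def Sub.comp {g h k : Arity} (σ : Sub C g h) (τ : Sub C h k) : Sub C g k := fun c x =>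
  match σ c x with
  | .inl y => τ c y
  | .inr F => .inr (Obj.inst (τ.lift c) F)

/-- Instantiation in every entry of an abstraction sequence. -/
def AbsSeq.inst {g h α : Arity} (F : AbsSeq C g α) (σ : Sub C g h) : AbsSeq C h α :=
  fun β v => Obj.inst (σ.lift β) (F β v)

theorem Obj.inst_var_inr' {g h α : Arity} (σ : Sub C g h) (x : Var g α) (G : AbsSeq C g α)
    (F : Abs C h α) (hx : σ α x = .inr F) :
    Obj.inst σ (.var x G) = Obj.inst (Sub.block (G.inst σ)) F := by
  rw [Obj.inst_var_inr σ x G F hx, employ_eq]; rfl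

/-! ### The algebra of renaming and instantiation -/

theorem Ren.lift_comp {g h k : Arity} (ρ : Ren g h) (θ : Ren h k) (α : Arity) :
    (fun c x => θ.lift α c (ρ.lift α c x)) = Ren.lift (fun c x => θ c (ρ c x)) α := by
  funext c x
  rcases Var.inl_or_inr α x with ⟨y, rfl⟩ | ⟨v, rfl⟩ <;> simp

theorem Obj.rename_rename {g : Arity} (M : Obj C g) : ∀ {h k : Arity} (ρ : Ren g h) (θ : Ren h k),
    (M.rename h ρ).rename k θ = M.rename k (fun c x => θ c (ρ c x)) := by
  induction M with
  | var x F ih => intro h k ρ θ; simp only [Obj.rename, ih, Ren.lift_comp]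
  | const c F ih => intro h k ρ θ; simp only [Obj.rename, ih, Ren.lift_comp]

theorem Abs.rename_rename {g h k α : Arity} (F : Abs C g α) (ρ : Ren g h) (θ : Ren h k) :
    Abs.rename (Abs.rename F ρ) θ = Abs.rename F (fun c x => θ c (ρ c x)) := by
  simp only [Abs.rename, Obj.rename_rename, Ren.lift_comp]

theorem Sub.lift_afterRen {g h k : Arity} (ρ : Ren g h) (σ : Sub C h k) (α : Arity) :
    Sub.afterRen (ρ.lift α) (σ.lift α) = (Sub.afterRen ρ σ).lift α := by
  apply funext_append <;> intro c y <;> simp [Sub.afterRen]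

theorem Obj.inst_rename {g : Arity} (M : Obj C g) : ∀ {h k : Arity} (ρ : Ren g h) (σ : Sub C h k),
    Obj.inst σ (M.rename h ρ) = Obj.inst (Sub.afterRen ρ σ) M := by
  induction M with
  | @var g α x F ih =>
    intro h k ρ σ
    simp only [Obj.rename]
    cases hx : σ _ (ρ _ x) with
    | inl y =>
      rw [Obj.inst_var_inl _ _ _ y hx, Obj.inst_var_inl (Sub.afterRen ρ σ) _ _ y hx]
      simp only [ih, Sub.lift_afterRen]
    | inr P =>
      rw [Obj.inst_var_inr _ _ _ P hx, Obj.inst_var_inr (Sub.afterRen ρ σ) _ _ P hx]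
      simp only [ih, Sub.lift_afterRen]
  | const c F ih => intro h k ρ σ; simp only [Obj.rename, Obj.inst_const, ih, Sub.lift_afterRen]

theorem Abs.rename_wk_rename_lift {g h c : Arity} (ρ : Ren g h) (α : Arity) (F : Abs C g c) :
    Abs.rename (Abs.rename F (Ren.wk g α)) (ρ.lift α) =
      Abs.rename (Abs.rename F ρ) (Ren.wk h α) := by
  rw [Abs.rename_rename, Abs.rename_rename]
  congr 1
  funext c x
  simp [Ren.wk]

theorem Sub.lift_thenRen {g h k : Arity} (σ : Sub C g h) (ρ : Ren h k) (α : Arity) :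
    (σ.lift α).thenRen (ρ.lift α) = (σ.thenRen ρ).lift α := by
  apply funext_append <;> intro c y
  · simp only [Sub.thenRen, Sub.lift_inl]
    cases σ c y with
    | inl z => simp [weakenVal]
    | inr F => simp [weakenVal, Abs.rename_wk_rename_lift]
  · simp [Sub.thenRen]

/-- All variables instantiated by `σ` have an arity of order less than `n`.  This is the measure
for the inductions on hereditary substitution: instantiating `F` for a variable of arity `α`
triggers an instantiation for variables whose arities are entries of `α`. -/
def Sub.Bounded {g h : Arity} (n : ℕ) (σ : Sub C g h) : Prop :=
  ∀ c (x : Var g c) (F : Abs C h c), σ c x = .inr F → c.order < n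

theorem Sub.Bounded.lift {g h : Arity} {n : ℕ} {σ : Sub C g h} (hσ : σ.Bounded n) (α : Arity) :
    (σ.lift α).Bounded n := by
  intro c x F hx
  rcases Var.inl_or_inr α x with ⟨y, rfl⟩ | ⟨v, rfl⟩
  · rw [Sub.lift_inl] at hx
    cases hy : σ c y with
    | inl z => rw [hy] at hx; cases hx
    | inr G => exact hσ c y G hy
  · simp at hx

theorem Sub.bounded_order {g h : Arity} (σ : Sub C g h) : σ.Bounded g.order :=
  fun _ x _ _ => x.order_lt

theorem Sub.bounded_block {g α : Arity} (H : AbsSeq C g α) : (Sub.block H).Bounded α.order := by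
  intro c x F hx
  rcases Var.inl_or_inr α x with ⟨y, rfl⟩ | ⟨v, rfl⟩
  · rw [Sub.block_eq_cons, Sub.cons_inl] at hx; cases hx
  · exact v.order_lt

theorem Sub.block_thenRen {g h α : Arity} (H : AbsSeq C g α) (ρ : Ren g h) :
    (Sub.block H).thenRen ρ =
      Sub.afterRen (ρ.lift α) (Sub.block (fun β v => Abs.rename (H β v) ρ)) := by
  apply funext_append <;> intro c y <;>
    simp [Sub.thenRen, Sub.afterRen, Sub.block_eq_cons, Sub.id]

/-- Renaming after instantiation, by induction on the orders of the instantiated arities and, for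
each bound, on the object. -/
theorem Obj.rename_inst_of_bounded (n : ℕ) : ∀ {g : Arity} (M : Obj C g) {h k : Arity}
    (σ : Sub C g h) (ρ : Ren h k), σ.Bounded n →
    (Obj.inst σ M).rename k ρ = Obj.inst (σ.thenRen ρ) M := by
  induction n using Nat.strong_induction_on with
  | _ n IH =>
  intro g M
  induction M with
  | @var g α x F ih =>
    intro h k σ ρ hσ
    have hF : ∀ β v, Abs.rename (AbsSeq.inst F σ β v) ρ = AbsSeq.inst F (σ.thenRen ρ) β v := by
      intro β v
      simp only [AbsSeq.inst, Abs.rename]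
      rw [ih β v _ _ (hσ.lift β), Sub.lift_thenRen]
    cases hx : σ _ x with
    | inl y =>
      have hy : σ.thenRen ρ _ x = .inl (ρ _ y) := by simp [Sub.thenRen, hx]
      rw [Obj.inst_var_inl _ _ _ y hx, Obj.inst_var_inl _ _ _ _ hy]
      simp only [Obj.rename]
      congr 1
      funext β v
      exact hF β v
    | inr P =>
      have hy : σ.thenRen ρ _ x = .inr (Abs.rename P ρ) := by simp [Sub.thenRen, hx]
      rw [Obj.inst_var_inr' _ _ _ P hx, Obj.inst_var_inr' _ _ _ _ hy,
        IH _ (hσ _ _ _ hx) P _ _ (Sub.bounded_block _), Sub.block_thenRen, Abs.rename,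
        Obj.inst_rename]
      simp only [hF]
  | const c F ih =>
    intro h k σ ρ hσ
    simp only [Obj.inst_const, Obj.rename]
    congr 1
    funext β v
    rw [ih β v _ _ (hσ.lift β), Sub.lift_thenRen]

theorem Obj.rename_inst {g h k : Arity} (M : Obj C g) (σ : Sub C g h) (ρ : Ren h k) :
    (Obj.inst σ M).rename k ρ = Obj.inst (σ.thenRen ρ) M :=
  Obj.rename_inst_of_bounded _ M σ ρ σ.bounded_order

theorem Obj.inst_lift_rename_wk {g h c : Arity} (τ : Sub C g h) (α : Arity) (F : Abs C g c) :
    Obj.inst ((τ.lift α).lift c) (Abs.rename F (Ren.wk g α)) =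
      Abs.rename (Obj.inst (τ.lift c) F) (Ren.wk h α) := by
  simp only [Abs.rename]
  rw [Obj.inst_rename, Obj.rename_inst, Sub.lift_afterRen, Sub.lift_thenRen]
  congr 2
  funext b x
  simp only [Sub.afterRen, Ren.wk, Sub.lift_inl, Sub.thenRen]
  cases τ b x <;> rfl

theorem Sub.lift_comp {g h k : Arity} (σ : Sub C g h) (τ : Sub C h k) (α : Arity) :
    (σ.comp τ).lift α = (σ.lift α).comp (τ.lift α) := by
  apply funext_append <;> intro c y
  · simp only [Sub.comp, Sub.lift_inl]
    cases σ c y with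
    | inl z => simp [weakenVal]
    | inr F => simp [weakenVal, Obj.inst_lift_rename_wk]
  · simp [Sub.comp]

theorem Obj.inst_lift_cons_rename_wk {g h α c : Arity} (τ : Sub C g h) (H : AbsSeq C h α)
    (F : Abs C g c) :
    Obj.inst ((τ.cons H).lift c) (Abs.rename F (Ren.wk g α)) = Obj.inst (τ.lift c) F := by
  rw [Abs.rename, Obj.inst_rename, Sub.lift_afterRen]
  congr 2
  funext b x
  simp [Sub.afterRen, Ren.wk]

theorem Sub.lift_comp_cons {g h k α : Arity} (σ : Sub C g h) (τ : Sub C h k) (H : AbsSeq C k α) :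
    (σ.lift α).comp (τ.cons H) = (σ.comp τ).cons H := by
  apply funext_append <;> intro c y
  · simp only [Sub.comp, Sub.lift_inl, Sub.cons_inl]
    cases σ c y with
    | inl z => simp [weakenVal]
    | inr F => simp [weakenVal, Obj.inst_lift_cons_rename_wk]
  · simp [Sub.comp]

theorem Sub.cons_comp {g h k α : Arity} (σ : Sub C g h) (τ : Sub C h k) (H : AbsSeq C h α) :
    (σ.cons H).comp τ = (σ.comp τ).cons (H.inst τ) := by
  apply funext_append <;> intro c y <;> simp [Sub.comp, AbsSeq.inst]

@[simp] theorem Sub.id_comp {g h : Arity} (σ : Sub C g h) : (Sub.id g).comp σ = σ := rfl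

theorem Sub.lift_id (g α : Arity) : (Sub.id g).lift α = (Sub.id (g ⧺ α) : Sub C _ _) := by
  apply funext_append <;> intro c y <;> simp [Sub.id, weakenVal]

theorem Obj.inst_id {g : Arity} (M : Obj C g) : Obj.inst (Sub.id g) M = M := by
  induction M with
  | var x F ih =>
    rw [Obj.inst_var_inl _ _ _ x rfl]
    congr 1
    funext β v
    rw [Sub.lift_id, ih]
  | const c F ih =>
    rw [Obj.inst_const]
    congr 1
    funext β v
    rw [Sub.lift_id, ih]

@[simp] theorem Sub.comp_id {g h : Arity} (σ : Sub C g h) : σ.comp (Sub.id h) = σ := by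
  funext c x
  simp only [Sub.comp]
  cases σ c x with
  | inl y => rfl
  | inr F => simp [Sub.lift_id, Obj.inst_id]

/-- The composition law under bounds `s` and `t` on the orders of the arities that `σ` and `τ`
instantiate, by induction on `s + t` and, for each sum, on the object. -/
theorem Obj.inst_inst_of_bounded (n : ℕ) : ∀ {g : Arity} (M : Obj C g) {h k : Arity} {s t : ℕ}
    (σ : Sub C g h) (τ : Sub C h k), s + t = n → σ.Bounded s → τ.Bounded t →
    Obj.inst τ (Obj.inst σ M) = Obj.inst (σ.comp τ) M := by
  induction n using Nat.strong_induction_on with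
  | _ n IH =>
  intro g M
  induction M with
  | @var g α x F ih =>
    intro h k s t σ τ hn hσ hτ
    have hF : (AbsSeq.inst F σ).inst τ = AbsSeq.inst F (σ.comp τ) := by
      funext β v
      simp only [AbsSeq.inst]
      rw [ih β v _ _ hn (hσ.lift β) (hτ.lift β), Sub.lift_comp]
    cases hx : σ _ x with
    | inl y =>
      rw [Obj.inst_var_inl _ _ _ y hx]
      cases hy : τ _ y with
      | inl z =>
        have hz : σ.comp τ _ x = .inl z := by simp [Sub.comp, hx, hy]
        rw [Obj.inst_var_inl _ _ _ z hy, Obj.inst_var_inl _ _ _ z hz]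
        exact congrArg (Obj.var z) hF
      | inr P =>
        have hz : σ.comp τ _ x = .inr P := by simp [Sub.comp, hx, hy]
        rw [Obj.inst_var_inr' _ _ _ P hy, Obj.inst_var_inr' _ _ _ P hz, ← hF]
        rfl
    | inr P =>
      have hz : σ.comp τ _ x = .inr (Obj.inst (τ.lift _) P) := by simp [Sub.comp, hx]
      have hα := hσ _ _ _ hx
      -- The instantiations triggered by `P` are for entries of the arity of `x`, so in both
      -- commutations below the sum of the bounds has dropped.
      rw [Obj.inst_var_inr' _ _ _ P hx, Obj.inst_var_inr' _ _ _ _ hz,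
        IH (α.order + t) (by omega) P _ _ rfl (Sub.bounded_block _) hτ,
        IH (t + α.order) (by omega) P _ _ rfl (hτ.lift _) (Sub.bounded_block _),
        Sub.block_eq_cons, Sub.block_eq_cons, Sub.cons_comp, Sub.lift_comp_cons, hF]
      simp
  | const c F ih =>
    intro h k s t σ τ hn hσ hτ
    simp only [Obj.inst_const]
    congr 1
    funext β v
    rw [ih β v _ _ hn (hσ.lift β) (hτ.lift β), Sub.lift_comp]

/-- The composition law of hereditary substitution. -/
theorem Obj.inst_inst {g h k : Arity} (M : Obj C g) (σ : Sub C g h) (τ : Sub C h k) :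
    Obj.inst τ (Obj.inst σ M) = Obj.inst (σ.comp τ) M :=
  Obj.inst_inst_of_bounded _ M σ τ rfl σ.bounded_order τ.bounded_order

theorem Sub.lift_ofRen {g h : Arity} (ρ : Ren g h) (α : Arity) :
    (Sub.ofRen ρ : Sub C g h).lift α = Sub.ofRen (ρ.lift α) := by
  apply funext_append <;> intro c y <;> simp [Sub.ofRen, weakenVal]

theorem Obj.rename_eq_inst {g h : Arity} (M : Obj C g) (ρ : Ren g h) :
    M.rename h ρ = Obj.inst (Sub.ofRen ρ) M := by
  induction M generalizing h with
  | var x F ih =>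
    rw [Obj.inst_var_inl _ _ _ (ρ _ x) rfl]
    simp only [Obj.rename, ih, Sub.lift_ofRen]
  | const c F ih => simp only [Obj.rename, Obj.inst_const, ih, Sub.lift_ofRen]

/-! ### Kinds -/

theorem BaseKind.inst_inst {g h k : Arity} (T : BaseKind C g) (σ : Sub C g h) (τ : Sub C h k) :
    (T.inst σ).inst τ = T.inst (σ.comp τ) := by
  cases T <;> simp [BaseKind.inst, Obj.inst_inst]

theorem BaseKind.inst_id {g : Arity} (T : BaseKind C g) : T.inst (Sub.id g) = T := by
  cases T <;> simp [BaseKind.inst, Obj.inst_id]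

theorem BaseKind.rename_eq_inst {g h : Arity} (T : BaseKind C g) (ρ : Ren g h) :
    T.rename ρ = T.inst (Sub.ofRen ρ) := by
  cases T <;> simp [BaseKind.inst, BaseKind.rename, Obj.rename_eq_inst]

theorem Tele.inst_inst {g α : Arity} (Δ : Tele C g α) : ∀ {h k : Arity} (σ : Sub C g h)
    (τ : Sub C h k), (Δ.inst σ).inst τ = Δ.inst (σ.comp τ) := by
  induction Δ with
  | nil => intros; rfl
  | snoc Δ Θ T ihΔ ihΘ =>
    intro h k σ τ
    simp only [Tele.inst, ihΔ, ihΘ, BaseKind.inst_inst, Sub.lift_comp]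

theorem Tele.inst_id {g α : Arity} (Δ : Tele C g α) : Δ.inst (Sub.id g) = Δ := by
  induction Δ with
  | nil => rfl
  | snoc Δ Θ T ihΔ ihΘ => simp only [Tele.inst, Sub.lift_id, ihΔ, ihΘ, BaseKind.inst_id]

theorem Tele.rename_eq_inst {g α : Arity} (Δ : Tele C g α) : ∀ {h : Arity} (ρ : Ren g h),
    Δ.rename h ρ = Δ.inst (Sub.ofRen ρ) := by
  induction Δ with
  | nil => intros; rfl
  | snoc Δ Θ T ihΔ ihΘ =>
    intro h ρ
    simp only [Tele.inst, Tele.rename, Sub.lift_ofRen, ihΔ, ihΘ, BaseKind.rename_eq_inst]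

theorem Kind.inst_inst {g h k a : Arity} (K : Kind C g a) (σ : Sub C g h) (τ : Sub C h k) :
    (K.inst σ).inst τ = K.inst (σ.comp τ) := by
  simp only [Kind.inst, Tele.inst_inst, BaseKind.inst_inst, Sub.lift_comp]

theorem Kind.inst_id {g a : Arity} (K : Kind C g a) : K.inst (Sub.id g) = K := by
  simp only [Kind.inst, Tele.inst_id, BaseKind.inst_id, Sub.lift_id]

theorem Kind.rename_eq_inst {g h a : Arity} (K : Kind C g a) (ρ : Ren g h) :
    K.rename ρ = K.inst (Sub.ofRen ρ) := by
  simp only [Kind.inst, Kind.rename, Tele.rename_eq_inst, BaseKind.rename_eq_inst, Sub.lift_ofRen]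

/-! ### Variables as abstractions -/

/-- The long form of a variable `x` of arity `(α₁, …, αₙ)`, that is, the abstraction
`[x₁, …, xₙ] x[x₁, …, xₙ]` in which the `xᵢ` are in turn in long form. -/
def eta (C : Arity → Type u) (a : Arity) {g : Arity} (x : Var g a) : Abs C g a :=
  .var (Var.inl x a) (fun β v =>
    have : β.order < a.order := v.order_lt
    eta C β (Var.inr g v))
termination_by a.order

/-- The abstraction that a substitution assigns to a variable, a variable that is kept
being put into long form. -/
def Sub.abs {g h c : Arity} (σ : Sub C g h) (x : Var g c) : Abs C h c :=
  match σ c x with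
  | .inl y => eta C c y
  | .inr F => F

theorem rename_eta {a : Arity} : ∀ {g h : Arity} (x : Var g a) (ρ : Ren g h),
    Abs.rename (eta C a x) ρ = eta C a (ρ a x) := by
  induction hn : a.order using Nat.strong_induction_on generalizing a with
  | _ n IH =>
  intro g h x ρ
  rw [eta, eta]
  simp only [Abs.rename, Obj.rename, Ren.lift_inl]
  congr 1
  funext β v
  have := IH β.order (hn ▸ v.order_lt) rfl (Var.inr g v) (ρ.lift a)
  simp only [Abs.rename, Ren.lift_inr] at this
  exact this

/-- Replacing variables by their long forms has no effect, provided that the defining property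
of long forms is known for the entries of the arities of these variables. -/
theorem Obj.inst_eq_self_of_eta {g : Arity} (M : Obj C g) : ∀ (κ : Sub C g g),
    (∀ c (x : Var g c), κ c x = .inl x ∨ (κ c x = .inr (eta C c x) ∧
      ∀ β (_ : Var c β) {h k : Arity} (y : Var h β) (σ : Sub C h k),
        Obj.inst (σ.lift β) (eta C β y) = σ.abs y)) →
    Obj.inst κ M = M := by
  induction M with
  | @var g α x F ih =>
    intro κ hκ
    have hF : AbsSeq.inst F κ = F := by
      funext β v
      refine ih β v (κ.lift β) ?_
      intro c y
      rcases Var.inl_or_inr β y with ⟨y, rfl⟩ | ⟨w, rfl⟩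
      · rcases hκ c y with h | ⟨h, h'⟩
        · left; simp [h, weakenVal]
        · right; refine ⟨?_, h'⟩; simp [h, weakenVal, rename_eta, Ren.wk]
      · left; simp
    rcases hκ _ x with h | ⟨h, h'⟩
    · rw [Obj.inst_var_inl _ _ _ _ h]
      exact congrArg (Obj.var x) hF
    · rw [Obj.inst_var_inr' _ _ _ _ h, hF, eta,
        Obj.inst_var_inl _ _ _ x (by simp [Sub.block_eq_cons, Sub.id])]
      congr 1
      funext β v
      rw [h' β v]
      simp [Sub.abs, Sub.block_eq_cons]
  | const c F ih =>
    intro κ hκ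
    rw [Obj.inst_const]
    congr 1
    funext β v
    refine ih β v (κ.lift β) ?_
    intro c y
    rcases Var.inl_or_inr β y with ⟨y, rfl⟩ | ⟨w, rfl⟩
    · rcases hκ c y with h | ⟨h, h'⟩
      · left; simp [h, weakenVal]
      · right; refine ⟨?_, h'⟩; simp [h, weakenVal, rename_eta, Ren.wk]
    · left; simp

/-- Instantiating in the long form of a variable yields the abstraction assigned to it. -/
theorem inst_eta {a : Arity} : ∀ {g h : Arity} (x : Var g a) (σ : Sub C g h),
    Obj.inst (σ.lift a) (eta C a x) = σ.abs x := by
  induction hn : a.order using Nat.strong_induction_on generalizing a with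
  | _ n IH =>
  intro g h x σ
  have hF : AbsSeq.inst (fun β (v : Var a β) => eta C β (Var.inr g v)) (σ.lift a) =
      fun β v => eta C β (Var.inr h v) := by
    funext β v
    simp only [AbsSeq.inst]
    rw [IH β.order (hn ▸ v.order_lt) rfl]
    simp [Sub.abs]
  rw [eta]
  cases hx : σ a x with
  | inl y =>
    rw [Obj.inst_var_inl _ _ _ (Var.inl y a) (by simp [hx, weakenVal])]
    simp only [Sub.abs, hx]
    conv_rhs => rw [eta]
    exact congrArg (Obj.var _) hF
  | inr F =>
    rw [Obj.inst_var_inr' _ _ _ (Abs.rename F (Ren.wk h a)) (by simp [hx, weakenVal]), hF]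
    simp only [Sub.abs, hx]
    rw [Abs.rename, Obj.inst_rename]
    apply Obj.inst_eq_self_of_eta
    intro c y
    rcases Var.inl_or_inr a y with ⟨y, rfl⟩ | ⟨v, rfl⟩
    · left; simp [Sub.afterRen, Sub.block_eq_cons, Ren.wk, Sub.id]
    · right
      refine ⟨by simp [Sub.afterRen, Sub.block_eq_cons], ?_⟩
      intro β w h k z τ
      exact IH β.order (hn ▸ w.order_lt.trans v.order_lt) rfl z τ

/-- `{σ} x[F₁, …, Fₙ] = σ(x) • {σ}F₁ • ⋯ • {σ}Fₙ`, also for the variables kept by `σ`. -/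
theorem Obj.inst_var {g h α : Arity} (σ : Sub C g h) (x : Var g α) (F : AbsSeq C g α) :
    Obj.inst σ (.var x F) = Obj.inst (Sub.block (F.inst σ)) (σ.abs x) := by
  cases hx : σ α x with
  | inl y =>
    rw [Obj.inst_var_inl _ _ _ y hx]
    simp only [Sub.abs, hx]
    rw [eta, Obj.inst_var_inl _ _ _ y (by simp [Sub.block_eq_cons, Sub.id])]
    congr 1
    funext β v
    rw [inst_eta]
    simp [Sub.abs, Sub.block_eq_cons, AbsSeq.inst]
  | inr P =>
    rw [Obj.inst_var_inr' _ _ _ P hx]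
    simp only [Sub.abs, hx]

theorem Sub.abs_comp {g h k c : Arity} (σ : Sub C g h) (τ : Sub C h k) (x : Var g c) :
    (σ.comp τ).abs x = Obj.inst (τ.lift c) (σ.abs x) := by
  simp only [Sub.abs, Sub.comp]
  cases σ c x with
  | inl y => rw [inst_eta]; rfl
  | inr F => rfl

/-- Two substitutions are equivalent if they agree once the variables they keep are put into
long form. -/
def Sub.Equiv {g h : Arity} (σ τ : Sub C g h) : Prop := ∀ c (x : Var g c), σ.abs x = τ.abs x

theorem Sub.abs_lift_inl {g h c : Arity} (σ : Sub C g h) (α : Arity) (y : Var g c) :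
    (σ.lift α).abs (Var.inl y α) = Abs.rename (σ.abs y) (Ren.wk h α) := by
  simp only [Sub.abs, Sub.lift_inl]
  cases σ c y with
  | inl z => simp [weakenVal, rename_eta, Ren.wk]
  | inr F => rfl

theorem Sub.Equiv.lift {g h : Arity} {σ τ : Sub C g h} (e : σ.Equiv τ) (α : Arity) :
    (σ.lift α).Equiv (τ.lift α) := by
  intro c x
  rcases Var.inl_or_inr α x with ⟨y, rfl⟩ | ⟨v, rfl⟩
  · rw [Sub.abs_lift_inl, Sub.abs_lift_inl, e c y]
  · simp [Sub.abs]

/-- Instantiation does not distinguish equivalent substitutions. -/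
theorem Obj.inst_congr {g : Arity} (M : Obj C g) : ∀ {h : Arity} {σ τ : Sub C g h},
    σ.Equiv τ → M.inst σ = M.inst τ := by
  induction M with
  | var x F ih =>
    intro h σ τ e
    have hF : AbsSeq.inst F σ = AbsSeq.inst F τ := by
      funext β v
      exact ih β v (e.lift β)
    rw [Obj.inst_var, Obj.inst_var, hF, e]
  | const c F ih =>
    intro h σ τ e
    rw [Obj.inst_const, Obj.inst_const]
    congr 1
    funext β v
    exact ih β v (e.lift β)

theorem BaseKind.inst_congr {g h : Arity} (T : BaseKind C g) {σ τ : Sub C g h}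
    (e : σ.Equiv τ) : T.inst σ = T.inst τ := by
  cases T <;> simp [BaseKind.inst, Obj.inst_congr _ e]

theorem Tele.inst_congr {g α : Arity} (Δ : Tele C g α) : ∀ {h : Arity} {σ τ : Sub C g h},
    σ.Equiv τ → Δ.inst σ = Δ.inst τ := by
  induction Δ with
  | nil => intros; rfl
  | snoc Δ Θ T ihΔ ihΘ =>
    intro h σ τ e
    simp only [Tele.inst, ihΔ e, ihΘ (e.lift _), BaseKind.inst_congr T ((e.lift _).lift _)]

theorem Kind.inst_congr {g h a : Arity} (K : Kind C g a) {σ τ : Sub C g h}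
    (e : σ.Equiv τ) : K.inst σ = K.inst τ := by
  simp only [Kind.inst, Tele.inst_congr _ e, BaseKind.inst_congr _ (e.lift a)]

/-- The sequence of the variables of a block, in long form. -/
def etaSeq (C : Arity → Type u) (g α : Arity) : AbsSeq C (g ⧺ α) α :=
  fun β v => eta C β (Var.inr g v)

theorem Sub.wk_etaSeq_equiv (g α : Arity) :
    ((Sub.ofRen (Ren.wk g α)).cons (etaSeq C g α)).Equiv (Sub.id (g ⧺ α)) := by
  intro c x
  rcases Var.inl_or_inr α x with ⟨y, rfl⟩ | ⟨v, rfl⟩ <;>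
    simp [Sub.abs, Sub.ofRen, Ren.wk, Sub.id, etaSeq]

theorem Obj.inst_wk_etaSeq {g α : Arity} (M : Obj C (g ⧺ α)) :
    M.inst ((Sub.ofRen (Ren.wk g α)).cons (etaSeq C g α)) = M := by
  rw [Obj.inst_congr M (Sub.wk_etaSeq_equiv g α), Obj.inst_id]

theorem BaseKind.inst_wk_etaSeq {g α : Arity} (T : BaseKind C (g ⧺ α)) :
    T.inst ((Sub.ofRen (Ren.wk g α)).cons (etaSeq C g α)) = T := by
  rw [BaseKind.inst_congr T (Sub.wk_etaSeq_equiv g α), BaseKind.inst_id]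

theorem Kind.inst_wk_etaSeq {g α a : Arity} (K : Kind C (g ⧺ α) a) :
    K.inst ((Sub.ofRen (Ren.wk g α)).cons (etaSeq C g α)) = K := by
  rw [Kind.inst_congr K (Sub.wk_etaSeq_equiv g α), Kind.inst_id]

/-! ### The logical relation -/

/-- All entries of a telescope but the last. -/
def Tele.init {g α a : Arity} : Tele C g (.snoc α a) → Tele C g α
  | .snoc Δ _ _ => Δ

/-- The last kind of a telescope. -/
def Tele.final {g α a : Arity} : Tele C g (.snoc α a) → Kind C (g ⧺ α) a
  | .snoc _ Θ T => ⟨Θ, T⟩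

theorem Tele.init_inst {g h α a : Arity} (Δ : Tele C g (.snoc α a)) (σ : Sub C g h) :
    (Δ.inst σ).init = Δ.init.inst σ := by
  cases Δ; rfl

theorem Tele.final_inst {g h α a : Arity} (Δ : Tele C g (.snoc α a)) (σ : Sub C g h) :
    (Δ.inst σ).final = Δ.final.inst (σ.lift α) := by
  cases Δ; rfl

/-- Morphisms of contexts: a renaming `ρ` of the variables of `Ψ` into the valid context `Ψ'` that
respects the kinds.  The valid contexts and these morphisms are the worlds of the Kripke logical
relation. -/
structure Mor (S : Spec C) {p q : Arity} (Ψ : Ctx C p) (Ψ' : Ctx C q) (ρ : Ren p q) : Prop where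
  valid : Derivable S Ψ' .valid
  lookup : ∀ {a : Arity} (x : Var p a), Ψ'.lookup (ρ a x) = (Ψ.lookup x).inst (Sub.ofRen ρ)

theorem Sub.ofRen_comp {g h k : Arity} (ρ : Ren g h) (θ : Ren h k) :
    (Sub.ofRen ρ : Sub C g h).comp (Sub.ofRen θ) = Sub.ofRen (fun c x => θ c (ρ c x)) := rfl

theorem Sub.ofRen_id (g : Arity) : (Sub.ofRen fun _ x => x : Sub C g g) = Sub.id g := rfl

theorem Mor.id {S : Spec C} {p : Arity} {Ψ : Ctx C p} (h : Derivable S Ψ .valid) :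
    Mor S Ψ Ψ (fun _ x => x) :=
  ⟨h, fun _ => (Kind.inst_id _).symm⟩

theorem Mor.comp {S : Spec C} {p q r : Arity} {Ψ : Ctx C p} {Ψ' : Ctx C q} {Ψ'' : Ctx C r}
    {ρ : Ren p q} {θ : Ren q r} (h : Mor S Ψ Ψ' ρ) (h' : Mor S Ψ' Ψ'' θ) :
    Mor S Ψ Ψ'' (fun c x => θ c (ρ c x)) :=
  ⟨h'.valid, fun x => by rw [h'.lookup, h.lookup, Kind.inst_inst]; rfl⟩

theorem Mor.snoc {S : Spec C} {p a : Arity} {Ψ : Ctx C p} {K : Kind C p a}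
    (h : Derivable S (Ψ.snoc K) .valid) : Mor S Ψ (Ψ.snoc K) (fun _ x => .prev x) :=
  ⟨h, fun x => by rw [← Kind.rename_eq_inst]; rfl⟩

theorem Ctx.lookup_append_inl {g α a : Arity} (Γ : Ctx C g) (Θ : Tele C g α) (x : Var g a) :
    (Γ.append Θ).lookup (Var.inl x α) = (Γ.lookup x).inst (Sub.ofRen (Ren.wk g α)) := by
  induction Θ with
  | nil => exact (Kind.inst_id _).symm
  | snoc Δ Θ T ihΔ _ =>
    simp only [Ctx.append, Var.inl, Ctx.lookup]
    rw [ihΔ, Kind.rename_eq_inst, Kind.inst_inst]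
    rfl

theorem Mor.append {S : Spec C} {p α : Arity} {Ψ : Ctx C p} {Θ : Tele C p α}
    (h : Derivable S (Ψ.append Θ) .valid) : Mor S Ψ (Ψ.append Θ) (Ren.wk p α) :=
  ⟨h, fun x => Ctx.lookup_append_inl Ψ Θ x⟩

/-- Two objects are related at a base kind if both have this kind and are equal at it, in every
later world. -/
def BaseRel (S : Spec C) {p : Arity} (Ψ : Ctx C p) (M N : Obj C p) (T : BaseKind C p) : Prop :=
  ∀ ⦃q : Arity⦄ (Ψ' : Ctx C q) (ρ : Ren p q), Mor S Ψ Ψ' ρ →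
    Derivable S Ψ' (.hasKind (M.inst (Sub.ofRen ρ)) (T.inst (Sub.ofRen ρ))) ∧
    Derivable S Ψ' (.hasKind (N.inst (Sub.ofRen ρ)) (T.inst (Sub.ofRen ρ))) ∧
    Derivable S Ψ' (.eq (M.inst (Sub.ofRen ρ)) (N.inst (Sub.ofRen ρ)) (T.inst (Sub.ofRen ρ)))

/-- Two base kinds are related if both are `Type`, or if they are `El A` and `El B` with `A` and `B`
related at `Type`. -/
def BaseKindRel (S : Spec C) {p : Arity} (Ψ : Ctx C p) : BaseKind C p → BaseKind C p → Prop
  | .type, .type => True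
  | .el A, .el B => BaseRel S Ψ A B .type
  | _, _ => False

/-- Relatedness of `a`-ary abstractions at a product kind, given relatedness `R` of `a`-ary
abstraction sequences: in every later world, related arguments are sent to related objects. -/
def AbsRelOf (S : Spec C) {a : Arity}
    (R : ∀ {q : Arity}, Ctx C q → Tele C q a → AbsSeq C q a → AbsSeq C q a → Prop)
    {p : Arity} (Ψ : Ctx C p) (K : Kind C p a) (F G : Abs C p a) : Prop :=
  ∀ ⦃q : Arity⦄ (Ψ' : Ctx C q) (ρ : Ren p q), Mor S Ψ Ψ' ρ → ∀ H H' : AbsSeq C q a,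
    R Ψ' (K.tele.inst (Sub.ofRen ρ)) H H' →
    BaseRel S Ψ' (Obj.inst ((Sub.ofRen ρ).cons H) F) (Obj.inst ((Sub.ofRen ρ).cons H') G)
      (K.base.inst ((Sub.ofRen ρ).cons H))

/-- Relatedness of abstraction sequences at a telescope, by recursion on the arity.  As for the
judgements `Γ ⊩ F⃗ = G⃗ :: Δ`, the entries of the first sequence are substituted in the kinds. -/
def SeqRel (S : Spec C) : (α : Arity) → {p : Arity} → Ctx C p → Tele C p α →
    AbsSeq C p α → AbsSeq C p α → Prop
  | .nil, _, _, _, _, _ => True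
  | .snoc α a, _, Ψ, Θ, H, H' =>
    SeqRel S α Ψ Θ.init (AbsSeq.init H) (AbsSeq.init H') ∧
      AbsRelOf S (SeqRel S a) Ψ (Θ.final.inst (Sub.block (AbsSeq.init H)))
        (AbsSeq.final H) (AbsSeq.final H')

/-- Relatedness of abstractions at a product kind. -/
def AbsRel (S : Spec C) {a p : Arity} (Ψ : Ctx C p) (K : Kind C p a) (F G : Abs C p a) : Prop :=
  AbsRelOf S (SeqRel S a) Ψ K F G

/-- Relatedness of `a`-ary product kinds, given relatedness `R` of `a`-ary telescopes: the
telescopes are related and, in every later world, related arguments yield related base kinds. -/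
def KindRelOf (S : Spec C) {a : Arity}
    (R : ∀ {q : Arity}, Ctx C q → Tele C q a → Tele C q a → Prop)
    {p : Arity} (Ψ : Ctx C p) (K K' : Kind C p a) : Prop :=
  R Ψ K.tele K'.tele ∧
  ∀ ⦃q : Arity⦄ (Ψ' : Ctx C q) (ρ : Ren p q), Mor S Ψ Ψ' ρ → ∀ H H' : AbsSeq C q a,
    SeqRel S a Ψ' (K.tele.inst (Sub.ofRen ρ)) H H' →
    BaseKindRel S Ψ' (K.base.inst ((Sub.ofRen ρ).cons H)) (K'.base.inst ((Sub.ofRen ρ).cons H'))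

/-- Relatedness of telescopes, by recursion on the arity: in every later world, related sequences
for the initial parts yield related final kinds. -/
def TeleRel (S : Spec C) : (α : Arity) → {p : Arity} → Ctx C p → Tele C p α → Tele C p α → Prop
  | .nil, _, _, _, _ => True
  | .snoc α a, p, Ψ, Θ, Θ' =>
    TeleRel S α Ψ Θ.init Θ'.init ∧
    ∀ ⦃q : Arity⦄ (Ψ' : Ctx C q) (ρ : Ren p q), Mor S Ψ Ψ' ρ → ∀ H H' : AbsSeq C q α,
      SeqRel S α Ψ' (Θ.init.inst (Sub.ofRen ρ)) H H' →
      KindRelOf S (TeleRel S a) Ψ' (Θ.final.inst ((Sub.ofRen ρ).cons H))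
        (Θ'.final.inst ((Sub.ofRen ρ).cons H'))

/-- Relatedness of product kinds. -/
def KindRel (S : Spec C) {a p : Arity} (Ψ : Ctx C p) (K K' : Kind C p a) : Prop :=
  KindRelOf S (TeleRel S a) Ψ K K'

section

variable {S : Spec C} {p q : Arity} {Ψ : Ctx C p} {Ψ' : Ctx C q} {ρ : Ren p q}

/-! ### Monotonicity -/

theorem BaseRel.mono {M N : Obj C p} {T : BaseKind C p} (h : BaseRel S Ψ M N T)
    (hρ : Mor S Ψ Ψ' ρ) :
    BaseRel S Ψ' (M.inst (Sub.ofRen ρ)) (N.inst (Sub.ofRen ρ)) (T.inst (Sub.ofRen ρ)) := by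
  intro r Ψ'' θ hθ
  rw [Obj.inst_inst, Obj.inst_inst, BaseKind.inst_inst]
  exact h Ψ'' _ (hρ.comp hθ)

theorem AbsRel.mono {a : Arity} {K : Kind C p a} {F G : Abs C p a} (h : AbsRel S Ψ K F G)
    (hρ : Mor S Ψ Ψ' ρ) :
    AbsRel S Ψ' (K.inst (Sub.ofRen ρ)) (Obj.inst ((Sub.ofRen ρ).lift a) F)
      (Obj.inst ((Sub.ofRen ρ).lift a) G) := by
  intro r Ψ'' θ hθ H H' hH
  have := h Ψ'' _ (hρ.comp hθ) H H' (by
    simpa only [Kind.inst, Tele.inst_inst, Sub.ofRen_comp] using hH)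
  simp only [Kind.inst, Obj.inst_inst, BaseKind.inst_inst, Sub.lift_comp_cons]
  exact this

theorem AbsSeq.init_inst {g h α a : Arity} (F : AbsSeq C g (.snoc α a)) (σ : Sub C g h) :
    AbsSeq.init (AbsSeq.inst F σ) = AbsSeq.inst (AbsSeq.init F) σ := rfl

theorem Kind.inst_lift_block {g h α a : Arity} (K : Kind C (g ⧺ α) a) (σ : Sub C g h)
    (H : AbsSeq C g α) :
    (K.inst (σ.lift α)).inst (Sub.block (H.inst σ)) = (K.inst (Sub.block H)).inst σ := by
  rw [Kind.inst_inst, Kind.inst_inst, Sub.block_eq_cons, Sub.block_eq_cons, Sub.lift_comp_cons,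
    Sub.cons_comp, Sub.comp_id, Sub.id_comp]

theorem SeqRel.mono {α : Arity} : ∀ {p q : Arity} {Ψ : Ctx C p} {Ψ' : Ctx C q} {ρ : Ren p q}
    {Θ : Tele C p α} {H H' : AbsSeq C p α}, SeqRel S α Ψ Θ H H' → Mor S Ψ Ψ' ρ →
    SeqRel S α Ψ' (Θ.inst (Sub.ofRen ρ)) (AbsSeq.inst H (Sub.ofRen ρ))
      (AbsSeq.inst H' (Sub.ofRen ρ)) := by
  induction α with
  | nil => intros; trivial
  | snoc α a ih _ =>
    intro p q Ψ Ψ' ρ Θ H H' h hρ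
    refine ⟨?_, ?_⟩
    · rw [Tele.init_inst]
      exact ih h.1 hρ
    · rw [Tele.final_inst, AbsSeq.init_inst, Kind.inst_lift_block]
      exact AbsRel.mono h.2 hρ

theorem TeleRel.mono {α : Arity} : ∀ {p q : Arity} {Ψ : Ctx C p} {Ψ' : Ctx C q} {ρ : Ren p q}
    {Θ Θ' : Tele C p α}, TeleRel S α Ψ Θ Θ' → Mor S Ψ Ψ' ρ →
    TeleRel S α Ψ' (Θ.inst (Sub.ofRen ρ)) (Θ'.inst (Sub.ofRen ρ)) := by
  induction α with
  | nil => intros; trivial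
  | snoc α a ih _ =>
    intro p q Ψ Ψ' ρ Θ Θ' h hρ
    refine ⟨?_, ?_⟩
    · rw [Tele.init_inst, Tele.init_inst]
      exact ih h.1 hρ
    · intro r Ψ'' θ hθ H H' hH
      rw [Tele.init_inst, Tele.inst_inst] at hH
      rw [Tele.final_inst, Tele.final_inst, Kind.inst_inst, Kind.inst_inst, Sub.lift_comp_cons,
        Sub.lift_comp_cons]
      exact h.2 Ψ'' _ (hρ.comp hθ) H H' hH

theorem KindRel.mono {a : Arity} {K K' : Kind C p a} (h : KindRel S Ψ K K')
    (hρ : Mor S Ψ Ψ' ρ) : KindRel S Ψ' (K.inst (Sub.ofRen ρ)) (K'.inst (Sub.ofRen ρ)) := by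
  refine ⟨TeleRel.mono h.1 hρ, ?_⟩
  intro r Ψ'' θ hθ H H' hH
  have := h.2 Ψ'' _ (hρ.comp hθ) H H' (by
    simpa only [Kind.inst, Tele.inst_inst, Sub.ofRen_comp] using hH)
  simp only [Kind.inst, BaseKind.inst_inst, Sub.lift_comp_cons]
  exact this

/-! ### Symmetry, transitivity and conversion -/

theorem BaseRel.symm {M N : Obj C p} {T : BaseKind C p} (h : BaseRel S Ψ M N T) :
    BaseRel S Ψ N M T := fun _ Ψ' ρ hρ =>
  ⟨(h Ψ' ρ hρ).2.1, (h Ψ' ρ hρ).1, (h Ψ' ρ hρ).2.2.sym⟩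

theorem BaseRel.trans {M N P : Obj C p} {T : BaseKind C p} (h : BaseRel S Ψ M N T)
    (h' : BaseRel S Ψ N P T) : BaseRel S Ψ M P T := fun _ Ψ' ρ hρ =>
  ⟨(h Ψ' ρ hρ).1, (h' Ψ' ρ hρ).2.1, (h Ψ' ρ hρ).2.2.trans (h' Ψ' ρ hρ).2.2⟩

theorem BaseRel.conv {M N : Obj C p} {T T' : BaseKind C p} (h : BaseRel S Ψ M N T)
    (hT : BaseKindRel S Ψ T T') : BaseRel S Ψ M N T' := by
  cases T <;> cases T'
  · exact h
  · exact hT.elim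
  · exact hT.elim
  · intro q Ψ' ρ hρ
    have h1 := h Ψ' ρ hρ
    have h2 := (hT Ψ' ρ hρ).2.2
    exact ⟨h1.1.conv h2, h1.2.1.conv h2, h1.2.2.conv_eq h2⟩

theorem BaseKindRel.symm {T T' : BaseKind C p} (h : BaseKindRel S Ψ T T') :
    BaseKindRel S Ψ T' T := by
  cases T <;> cases T' <;> first | exact h.elim | trivial | exact BaseRel.symm h

theorem BaseKindRel.trans {T T' T'' : BaseKind C p} (h : BaseKindRel S Ψ T T')
    (h' : BaseKindRel S Ψ T' T'') : BaseKindRel S Ψ T T'' := by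
  cases T <;> cases T' <;> cases T'' <;>
    first | exact h.elim | exact h'.elim | trivial | exact BaseRel.trans h h'

end

/-- The laws of relatedness at the arity `α`: it is a partial equivalence on telescopes and, at
a telescope related to itself, on abstraction sequences, and it only depends on the class of
the telescope. -/
structure TelePER (S : Spec C) (α : Arity) : Prop where
  tele_symm : ∀ {p : Arity} {Ψ : Ctx C p} {Θ Θ' : Tele C p α},
    TeleRel S α Ψ Θ Θ' → TeleRel S α Ψ Θ' Θ
  tele_trans : ∀ {p : Arity} {Ψ : Ctx C p} {Θ Θ' Θ'' : Tele C p α},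
    TeleRel S α Ψ Θ Θ' → TeleRel S α Ψ Θ' Θ'' → TeleRel S α Ψ Θ Θ''
  conv : ∀ {p : Arity} {Ψ : Ctx C p} {Θ Θ' : Tele C p α} {H H' : AbsSeq C p α},
    Derivable S Ψ .valid → TeleRel S α Ψ Θ Θ' → SeqRel S α Ψ Θ H H' → SeqRel S α Ψ Θ' H H'
  symm : ∀ {p : Arity} {Ψ : Ctx C p} {Θ : Tele C p α} {H H' : AbsSeq C p α},
    Derivable S Ψ .valid → TeleRel S α Ψ Θ Θ → SeqRel S α Ψ Θ H H' → SeqRel S α Ψ Θ H' H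
  trans : ∀ {p : Arity} {Ψ : Ctx C p} {Θ : Tele C p α} {H H' H'' : AbsSeq C p α},
    Derivable S Ψ .valid → TeleRel S α Ψ Θ Θ → SeqRel S α Ψ Θ H H' → SeqRel S α Ψ Θ H' H'' →
      SeqRel S α Ψ Θ H H''

theorem TeleRel.final_block {S : Spec C} {p α a : Arity} {Ψ : Ctx C p}
    (hΨ : Derivable S Ψ .valid) {Θ Θ' : Tele C p (.snoc α a)}
    (h : TeleRel S (.snoc α a) Ψ Θ Θ') {H H' : AbsSeq C p α} (hH : SeqRel S α Ψ Θ.init H H') :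
    KindRel S Ψ (Θ.final.inst (Sub.block H)) (Θ'.final.inst (Sub.block H')) :=
  h.2 Ψ _ (Mor.id hΨ) H H' (by rw [Sub.ofRen_id, Tele.inst_id]; exact hH)

namespace TelePER

variable {S : Spec C} {a p : Arity} {Ψ : Ctx C p} {K K' K'' : Kind C p a}

theorem tele_left (P : TelePER S a) {Θ Θ' : Tele C p a} (h : TeleRel S a Ψ Θ Θ') :
    TeleRel S a Ψ Θ Θ := P.tele_trans h (P.tele_symm h)

theorem left (P : TelePER S a) (hΨ : Derivable S Ψ .valid) {Θ : Tele C p a} {H H' : AbsSeq C p a}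
    (hΘ : TeleRel S a Ψ Θ Θ) (h : SeqRel S a Ψ Θ H H') : SeqRel S a Ψ Θ H H :=
  P.trans hΨ hΘ h (P.symm hΨ hΘ h)

theorem kind_symm (P : TelePER S a) (h : KindRel S Ψ K K') : KindRel S Ψ K' K := by
  refine ⟨P.tele_symm h.1, ?_⟩
  intro q Ψ' ρ hρ H H' hH
  have hT := TeleRel.mono h.1 hρ
  have hH' := P.conv hρ.valid (P.tele_symm hT) hH
  exact (h.2 Ψ' ρ hρ H' H (P.symm hρ.valid (P.tele_left hT) hH')).symm

theorem kind_trans (P : TelePER S a) (h : KindRel S Ψ K K') (h' : KindRel S Ψ K' K'') :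
    KindRel S Ψ K K'' := by
  refine ⟨P.tele_trans h.1 h'.1, ?_⟩
  intro q Ψ' ρ hρ H H' hH
  have hT := TeleRel.mono h.1 hρ
  exact (h.2 Ψ' ρ hρ H H (P.left hρ.valid (P.tele_left hT) hH)).trans
    (h'.2 Ψ' ρ hρ H H' (P.conv hρ.valid hT hH))

theorem kind_left (P : TelePER S a) (h : KindRel S Ψ K K') : KindRel S Ψ K K :=
  P.kind_trans h (P.kind_symm h)

theorem abs_conv (P : TelePER S a) (h : KindRel S Ψ K K') {F G : Abs C p a}
    (hF : AbsRel S Ψ K F G) : AbsRel S Ψ K' F G := by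
  intro q Ψ' ρ hρ H H' hH
  have hT := TeleRel.mono h.1 hρ
  have hH' := P.conv hρ.valid (P.tele_symm hT) hH
  exact BaseRel.conv (hF Ψ' ρ hρ H H' hH')
    (h.2 Ψ' ρ hρ H H (P.left hρ.valid (P.tele_left hT) hH'))

theorem abs_symm (P : TelePER S a) (h : KindRel S Ψ K K) {F G : Abs C p a}
    (hF : AbsRel S Ψ K F G) : AbsRel S Ψ K G F := by
  intro q Ψ' ρ hρ H H' hH
  have hH' := P.symm hρ.valid (TeleRel.mono h.1 hρ) hH
  exact BaseRel.symm (BaseRel.conv (hF Ψ' ρ hρ H' H hH') (h.2 Ψ' ρ hρ H' H hH'))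

theorem abs_trans (P : TelePER S a) (h : KindRel S Ψ K K) {F G F' : Abs C p a}
    (hF : AbsRel S Ψ K F G) (hG : AbsRel S Ψ K G F') : AbsRel S Ψ K F F' := by
  intro q Ψ' ρ hρ H H' hH
  exact BaseRel.trans (hF Ψ' ρ hρ H H (P.left hρ.valid (TeleRel.mono h.1 hρ) hH))
    (hG Ψ' ρ hρ H H' hH)

theorem nil (S : Spec C) : TelePER S .nil :=
  ⟨fun _ => trivial, fun _ _ => trivial, fun _ _ _ => trivial, fun _ _ _ => trivial,
    fun _ _ _ _ => trivial⟩

theorem snoc {α : Arity} (P : TelePER S α) (Q : TelePER S a) : TelePER S (.snoc α a) where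
  tele_symm := by
    intro p Ψ Θ Θ' h
    refine ⟨P.tele_symm h.1, ?_⟩
    intro q Ψ' ρ hρ H H' hH
    have hT := TeleRel.mono h.1 hρ
    have hH' := P.conv hρ.valid (P.tele_symm hT) hH
    exact Q.kind_symm (h.2 Ψ' ρ hρ H' H (P.symm hρ.valid (P.tele_left hT) hH'))
  tele_trans := by
    intro p Ψ Θ Θ' Θ'' h h'
    refine ⟨P.tele_trans h.1 h'.1, ?_⟩
    intro q Ψ' ρ hρ H H' hH
    have hT := TeleRel.mono h.1 hρ
    exact Q.kind_trans (h.2 Ψ' ρ hρ H H (P.left hρ.valid (P.tele_left hT) hH))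
      (h'.2 Ψ' ρ hρ H H' (P.conv hρ.valid hT hH))
  conv := by
    intro p Ψ Θ Θ' H H' hΨ h hH
    exact ⟨P.conv hΨ h.1 hH.1,
      Q.abs_conv (h.final_block hΨ (P.left hΨ (P.tele_left h.1) hH.1)) hH.2⟩
  symm := by
    intro p Ψ Θ H H' hΨ h hH
    have hK := h.final_block hΨ hH.1
    exact ⟨P.symm hΨ h.1 hH.1, Q.abs_conv hK (Q.abs_symm (Q.kind_left hK) hH.2)⟩
  trans := by
    intro p Ψ Θ H H' H'' hΨ h hH hH'
    have hK := h.final_block hΨ hH.1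
    exact ⟨P.trans hΨ h.1 hH.1 hH'.1,
      Q.abs_trans (Q.kind_left hK) hH.2 (Q.abs_conv (Q.kind_symm hK) hH'.2)⟩

theorem all (S : Spec C) (α : Arity) : TelePER S α := by
  induction α with
  | nil => exact nil S
  | snoc α a P Q => exact P.snoc Q

end TelePER

/-! ### From relatedness to derivability -/

section

variable {S : Spec C} {p a : Arity} {Ψ : Ctx C p}

theorem BaseRel.derivable (hΨ : Derivable S Ψ .valid) {M N : Obj C p} {T : BaseKind C p}
    (h : BaseRel S Ψ M N T) :
    Derivable S Ψ (.hasKind M T) ∧ Derivable S Ψ (.hasKind N T) ∧ Derivable S Ψ (.eq M N T) := by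
  simpa only [Sub.ofRen_id, Obj.inst_id, BaseKind.inst_id] using h Ψ _ (Mor.id hΨ)

theorem BaseKindRel.derives (hΨ : Derivable S Ψ .valid) {T T' : BaseKind C p}
    (h : BaseKindRel S Ψ T T') : Derives S (baseKindJ Ψ T) := by
  cases T <;> cases T'
  · exact hΨ
  · exact hΨ
  · exact h.elim
  · exact (BaseRel.derivable hΨ h).1

theorem BaseKindRel.hasKind (hΨ : Derivable S Ψ .valid) {M : Obj C p} {T T' : BaseKind C p}
    (h : BaseKindRel S Ψ T T') (hM : Derivable S Ψ (.hasKind M T)) :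
    Derivable S Ψ (.hasKind M T') := by
  cases T <;> cases T'
  · exact hM
  · exact h.elim
  · exact h.elim
  · exact hM.conv (BaseRel.derivable hΨ h).2.2

end

theorem BaseKind.inst_block_inst {g h α : Arity} (T : BaseKind C (g ⧺ α))
    (H : AbsSeq C g α) (σ : Sub C g h) :
    (T.inst (Sub.block H)).inst σ = (T.inst (σ.lift α)).inst (Sub.block (H.inst σ)) := by
  rw [BaseKind.inst_inst, BaseKind.inst_inst, Sub.block_eq_cons, Sub.block_eq_cons,
    Sub.lift_comp_cons, Sub.cons_comp, Sub.comp_id, Sub.id_comp]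

theorem Kind.rename_ofNil_inst {p q a : Arity} (K : Kind C .nil a) (σ : Sub C p q) :
    (K.rename (Ren.ofNil p)).inst σ = K.rename (Ren.ofNil q) := by
  rw [Kind.rename_eq_inst, Kind.rename_eq_inst, Kind.inst_inst]
  congr 1
  funext c x
  cases x

/-- The passage from relatedness to derivability at the arity `α`: a telescope related to itself
extends valid contexts, its variables are then related to themselves, and related sequences
satisfy the telescope and are equal at it. -/
structure Escape (S : Spec C) (α : Arity) : Prop where
  valid : ∀ {p : Arity} {Ψ : Ctx C p} {Θ : Tele C p α}, Derivable S Ψ .valid →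
    TeleRel S α Ψ Θ Θ → Derivable S (Ψ.append Θ) .valid
  vars : ∀ {p : Arity} {Ψ : Ctx C p} {Θ : Tele C p α}, Derivable S Ψ .valid →
    TeleRel S α Ψ Θ Θ →
    SeqRel S α (Ψ.append Θ) (Θ.inst (Sub.ofRen (Ren.wk p α))) (etaSeq C p α) (etaSeq C p α)
  sat : ∀ {p : Arity} {Ψ : Ctx C p} {Θ : Tele C p α} {H H' : AbsSeq C p α},
    Derivable S Ψ .valid → TeleRel S α Ψ Θ Θ → SeqRel S α Ψ Θ H H' →
    ∀ J ∈ satJ Ψ H Θ, Derivable S J.ctx J.body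
  satEq : ∀ {p : Arity} {Ψ : Ctx C p} {Θ : Tele C p α} {H H' : AbsSeq C p α},
    Derivable S Ψ .valid → TeleRel S α Ψ Θ Θ → SeqRel S α Ψ Θ H H' →
    ∀ J ∈ satEqJ Ψ H H' Θ, Derivable S J.ctx J.body

namespace Escape

variable {S : Spec C} {p a : Arity} {Ψ : Ctx C p} {K : Kind C p a}

theorem kind (E : Escape S a) (hΨ : Derivable S Ψ .valid) (hK : KindRel S Ψ K K) :
    Derives S (kindJ Ψ K) := by
  have hv := E.valid hΨ hK.1
  have h := hK.2 _ _ (Mor.append hv) _ _ (E.vars hΨ hK.1)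
  rw [BaseKind.inst_wk_etaSeq] at h
  exact h.derives hv

/-- Related abstractions are derivably of their kind and equal at it: apply them to the variables of
the telescope, in the world extended by the telescope. -/
theorem abs (E : Escape S a) (hΨ : Derivable S Ψ .valid) (hK : KindRel S Ψ K K)
    {F G : Abs C p a} (h : AbsRel S Ψ K F G) :
    Derives S (absJ Ψ F K) ∧ Derives S (absEqJ Ψ F G K) := by
  have hv := E.valid hΨ hK.1
  have h := h _ _ (Mor.append hv) _ _ (E.vars hΨ hK.1)
  rw [BaseKind.inst_wk_etaSeq, Obj.inst_wk_etaSeq, Obj.inst_wk_etaSeq] at h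
  exact ⟨(h.derivable hv).1, (h.derivable hv).2.2⟩

/-- A head `z` obeying the two rules for variables and constants sends related arguments to
related objects.  The kind of the second object has to be converted, which is possible since
related arguments yield related instances of the base kind. -/
theorem head (E : Escape S a) (hΨ : Derivable S Ψ .valid) (hK : KindRel S Ψ K K)
    (z : AbsSeq C p a → Obj C p)
    (hz : ∀ F, (∀ J ∈ satJ Ψ F K.tele, Derivable S J.ctx J.body) →
      Derivable S Ψ (.hasKind (z F) (K.base.inst (Sub.block F))))
    (hz' : ∀ F G, (∀ J ∈ satEqJ Ψ F G K.tele, Derivable S J.ctx J.body) →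
      Derivable S Ψ (.eq (z F) (z G) (K.base.inst (Sub.block F))))
    {H H' : AbsSeq C p a} (hH : SeqRel S a Ψ K.tele H H') :
    Derivable S Ψ (.hasKind (z H) (K.base.inst (Sub.block H))) ∧
    Derivable S Ψ (.hasKind (z H') (K.base.inst (Sub.block H))) ∧
    Derivable S Ψ (.eq (z H) (z H') (K.base.inst (Sub.block H))) := by
  have hH' := (TelePER.all S a).symm hΨ hK.1 hH
  have hT : BaseKindRel S Ψ (K.base.inst (Sub.block H')) (K.base.inst (Sub.block H)) :=
    hK.2 Ψ _ (Mor.id hΨ) _ _ (by rw [Sub.ofRen_id, Tele.inst_id]; exact hH')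
  exact ⟨hz H (E.sat hΨ hK.1 hH), hT.hasKind hΨ (hz H' (E.sat hΨ hK.1 hH')),
    hz' H H' (E.satEq hΨ hK.1 hH)⟩

theorem var (E : Escape S a) (x : Var p a) (hK : KindRel S Ψ (Ψ.lookup x) (Ψ.lookup x))
    {H H' : AbsSeq C p a} (hH : SeqRel S a Ψ (Ψ.lookup x).tele H H') :
    BaseRel S Ψ (.var x H) (.var x H') ((Ψ.lookup x).base.inst (Sub.block H)) := by
  intro q Ψ' ρ hρ
  have hK' := hK.mono hρ
  have hH' := hH.mono hρ
  rw [BaseKind.inst_block_inst, Obj.inst_var_inl _ _ _ (ρ _ x) rfl,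
    Obj.inst_var_inl _ _ _ (ρ _ x) rfl]
  refine E.head (K := (Ψ.lookup x).inst (Sub.ofRen ρ)) hρ.valid hK' (fun F => .var (ρ _ x) F)
    ?_ ?_ hH'
  · rw [← hρ.lookup]; exact Derivable.var _
  · rw [← hρ.lookup]; exact Derivable.var_eq _

theorem const (E : Escape S a) {c : C a} {K : Kind C .nil a} (hc : Decl.const c K ∈ S)
    (hK : KindRel S Ψ (K.rename (Ren.ofNil p)) (K.rename (Ren.ofNil p)))
    {H H' : AbsSeq C p a} (hH : SeqRel S a Ψ (K.rename (Ren.ofNil p)).tele H H') :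
    BaseRel S Ψ (.const c H) (.const c H')
      ((K.rename (Ren.ofNil p)).base.inst (Sub.block H)) := by
  intro q Ψ' ρ hρ
  have hK' := hK.mono hρ
  have hH' := hH.mono hρ
  rw [BaseKind.inst_block_inst, Obj.inst_const, Obj.inst_const]
  refine E.head (K := (K.rename (Ren.ofNil p)).inst (Sub.ofRen ρ)) hρ.valid hK'
    (fun F => .const c F) ?_ ?_ hH'
  · rw [Kind.rename_ofNil_inst]; exact Derivable.const hc
  · rw [Kind.rename_ofNil_inst]; exact Derivable.const_eq hc

/-- A variable is related to itself at a kind related to itself. -/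
theorem eta (E : Escape S a) (x : Var p a) (hK : KindRel S Ψ (Ψ.lookup x) (Ψ.lookup x)) :
    AbsRel S Ψ (Ψ.lookup x) (eta C a x) (eta C a x) := by
  intro q Ψ' ρ hρ H H' hH
  have hK' := hK.mono hρ
  rw [← hρ.lookup] at hK'
  have := E.var (ρ _ x) hK' (H := H) (H' := H') (by rw [hρ.lookup]; exact hH)
  rw [hρ.lookup] at this
  have e : ∀ H : AbsSeq C q a, Obj.inst ((Sub.ofRen ρ).cons H) (TF.eta C a x) =
      .var (ρ _ x) H := by
    intro H
    rw [TF.eta, Obj.inst_var_inl _ _ _ (ρ _ x) (by simp [Sub.ofRen])]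
    congr 1
    funext β v
    rw [inst_eta]
    simp [Sub.abs]
  rw [e, e]
  convert this using 1
  rw [Sub.block_eq_cons]
  simp only [Kind.inst, BaseKind.inst_inst, Sub.lift_comp_cons]
  rfl

theorem snoc_valid (E : Escape S a) (hΨ : Derivable S Ψ .valid) (hK : KindRel S Ψ K K) :
    Derivable S (Ψ.snoc K) .valid :=
  .ctxt (E.kind hΨ hK)

theorem snoc_last (E : Escape S a) (hΨ : Derivable S Ψ .valid) (hK : KindRel S Ψ K K) :
    AbsRel S (Ψ.snoc K) (K.inst (Sub.ofRen fun _ y => .prev y)) (TF.eta C a .last)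
      (TF.eta C a .last) := by
  have h := hK.mono (Mor.snoc (E.snoc_valid hΨ hK))
  rw [← Kind.rename_eq_inst] at h ⊢
  exact E.eta (Ψ := Ψ.snoc K) .last h

theorem nil (S : Spec C) : Escape S .nil where
  valid := by
    intro p Ψ Θ hΨ _
    cases Θ
    exact hΨ
  vars := fun _ _ => trivial
  sat := by
    intro p Ψ Θ H H' hΨ _ _ J hJ
    cases Θ
    rw [satJ, Set.mem_singleton_iff] at hJ
    subst hJ
    exact hΨ
  satEq := by
    intro p Ψ Θ H H' hΨ _ _ J hJ
    cases Θ
    rw [satEqJ, Set.mem_singleton_iff] at hJ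
    subst hJ
    exact hΨ

theorem snoc {α : Arity} (D : Escape S α) (E : Escape S a) : Escape S (.snoc α a) := by
  have hfinal : ∀ {p : Arity} {Ψ : Ctx C p} {Θ : Tele C p (.snoc α a)}, Derivable S Ψ .valid →
      TeleRel S (.snoc α a) Ψ Θ Θ → KindRel S (Ψ.append Θ.init) Θ.final Θ.final := by
    intro p Ψ Θ hΨ hΘ
    have := hΘ.2 _ _ (Mor.append (D.valid hΨ hΘ.1)) _ _ (D.vars hΨ hΘ.1)
    rwa [Kind.inst_wk_etaSeq] at this
  refine ⟨?_, ?_, ?_, ?_⟩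
  · intro p Ψ Θ hΨ hΘ
    have h := hfinal hΨ hΘ
    cases Θ
    exact E.snoc_valid (D.valid hΨ hΘ.1) h
  · intro p Ψ Θ hΨ hΘ
    have h := hfinal hΨ hΘ
    have hv := D.valid hΨ hΘ.1
    have hs := D.vars hΨ hΘ.1
    cases Θ with
    | snoc Δ Θ T =>
    have hm := Mor.snoc (E.snoc_valid hv h)
    -- The long forms of the variables of `Δ` in the extended context are the weakened ones, and
    -- instantiating them has no effect on the last kind but weakening.
    have he : AbsSeq.init (etaSeq C p (α.snoc a)) =
        AbsSeq.inst (etaSeq C p α) (Sub.ofRen fun _ y => .prev y) := by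
      funext β v
      simp only [AbsSeq.inst, etaSeq, inst_eta]
      rfl
    have hk : ((Tele.snoc Δ Θ T).inst (Sub.ofRen (Ren.wk p (α.snoc a)))).final.inst
        (Sub.block (AbsSeq.init (etaSeq C p (α.snoc a)))) =
        Kind.inst (Sub.ofRen fun _ y => .prev y) ⟨Θ, T⟩ := by
      rw [Tele.final_inst, Kind.inst_inst, Sub.block_eq_cons, Sub.lift_comp_cons]
      apply Kind.inst_congr
      intro c x
      rcases Var.inl_or_inr α x with ⟨y, rfl⟩ | ⟨v, rfl⟩
      · simp only [Sub.abs, Sub.cons_inl]; rfl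
      · simp only [Sub.abs, Sub.cons_inr]; rfl
    refine ⟨?_, ?_⟩
    · have := hs.mono hm
      rw [Tele.inst_inst, ← he] at this
      exact this
    · have := E.snoc_last hv h
      change AbsRel S _ _ _ _
      rw [hk]
      exact this
  · intro p Ψ Θ H H' hΨ hΘ hH J hJ
    have hK := hΘ.final_block hΨ hH.1
    cases Θ with
    | snoc Δ Θ T =>
    rcases hJ with hJ | hJ
    · exact D.sat hΨ hΘ.1 hH.1 J hJ
    · rw [Set.mem_singleton_iff] at hJ
      subst hJ
      exact (E.abs hΨ ((TelePER.all S a).kind_left hK) hH.2).1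
  · intro p Ψ Θ H H' hΨ hΘ hH J hJ
    have hK := hΘ.final_block hΨ hH.1
    cases Θ with
    | snoc Δ Θ T =>
    rcases hJ with hJ | hJ
    · exact D.satEq hΨ hΘ.1 hH.1 J hJ
    · rw [Set.mem_singleton_iff] at hJ
      subst hJ
      exact (E.abs hΨ ((TelePER.all S a).kind_left hK) hH.2).2

theorem all (S : Spec C) (α : Arity) : Escape S α := by
  induction α with
  | nil => exact nil S
  | snoc α a D E => exact D.snoc E

end Escape

/-! ### Environments -/

/-- Two substitutions are related environments for `Γ` if they send every variable of `Γ` to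
related abstractions. -/
def EnvRel (S : Spec C) {g p : Arity} (Ψ : Ctx C p) (Γ : Ctx C g) (σ τ : Sub C g p) : Prop :=
  ∀ ⦃a : Arity⦄ (x : Var g a), AbsRel S Ψ ((Γ.lookup x).inst σ) (σ.abs x) (τ.abs x)

/-- A context is semantically valid if related environments send each of its kinds to related
kinds. -/
def SemCtx (S : Spec C) : {g : Arity} → Ctx C g → Prop
  | _, .nil => True
  | _, .snoc (g := g) Γ K => SemCtx S Γ ∧ ∀ ⦃p : Arity⦄ (Ψ : Ctx C p) (σ τ : Sub C g p),
      Derivable S Ψ .valid → EnvRel S Ψ Γ σ τ → KindRel S Ψ (K.inst σ) (K.inst τ)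

/-- The restriction of a substitution to all variables but the last. -/
def Sub.init {g a p : Arity} (σ : Sub C (.snoc g a) p) : Sub C g p := fun c x => σ c (.prev x)

section

variable {S : Spec C} {g p : Arity} {Ψ : Ctx C p} {Γ : Ctx C g} {σ τ : Sub C g p}

theorem Kind.rename_prev_inst {a b : Arity} (K : Kind C g a) (σ : Sub C (.snoc g b) p) :
    (K.rename (fun _ y => .prev y)).inst σ = K.inst σ.init := by
  rw [Kind.rename_eq_inst, Kind.inst_inst]; rfl

theorem envRel_snoc {a : Arity} {K : Kind C g a} {σ τ : Sub C (.snoc g a) p} :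
    EnvRel S Ψ (Γ.snoc K) σ τ ↔ EnvRel S Ψ Γ σ.init τ.init ∧
      AbsRel S Ψ (K.inst σ.init) (σ.abs .last) (τ.abs .last) := by
  constructor
  · intro h
    refine ⟨fun b x => ?_, ?_⟩
    · have := h (.prev x)
      rwa [Ctx.lookup, Kind.rename_prev_inst] at this
    · have := h .last
      rwa [Ctx.lookup, Kind.rename_prev_inst] at this
  · rintro ⟨h, h'⟩ b x
    cases x with
    | last => rw [Ctx.lookup, Kind.rename_prev_inst]; exact h'
    | prev x => rw [Ctx.lookup, Kind.rename_prev_inst]; exact h x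

theorem EnvRel.congr {σ' τ' : Sub C g p} (h : EnvRel S Ψ Γ σ τ) (hσ : σ.Equiv σ')
    (hτ : τ.Equiv τ') : EnvRel S Ψ Γ σ' τ' := by
  intro a x
  rw [← Kind.inst_congr _ hσ, ← hσ, ← hτ]
  exact h x

theorem EnvRel.mono {q : Arity} {Ψ' : Ctx C q} {ρ : Ren p q} (h : EnvRel S Ψ Γ σ τ)
    (hρ : Mor S Ψ Ψ' ρ) :
    EnvRel S Ψ' Γ (σ.comp (Sub.ofRen ρ)) (τ.comp (Sub.ofRen ρ)) := by
  intro a x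
  rw [← Kind.inst_inst, Sub.abs_comp, Sub.abs_comp]
  exact (h x).mono hρ

theorem SemCtx.lookup (hΓ : SemCtx S Γ) (hΨ : Derivable S Ψ .valid) (h : EnvRel S Ψ Γ σ τ)
    {a : Arity} (x : Var g a) :
    KindRel S Ψ ((Γ.lookup x).inst σ) ((Γ.lookup x).inst τ) := by
  induction Γ with
  | nil => cases x
  | snoc Γ K ih =>
    rw [envRel_snoc] at h
    cases x with
    | last =>
      rw [Ctx.lookup, Kind.rename_prev_inst, Kind.rename_prev_inst]
      exact hΓ.2 Ψ _ _ hΨ h.1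
    | prev x =>
      rw [Ctx.lookup, Kind.rename_prev_inst, Kind.rename_prev_inst]
      exact ih hΓ.1 h.1 x

theorem EnvRel.symm (hΓ : SemCtx S Γ) (hΨ : Derivable S Ψ .valid) (h : EnvRel S Ψ Γ σ τ) :
    EnvRel S Ψ Γ τ σ := by
  intro a x
  have P := TelePER.all S a
  have hK := hΓ.lookup hΨ h x
  exact P.abs_conv hK (P.abs_symm (P.kind_left hK) (h x))

theorem EnvRel.left (hΓ : SemCtx S Γ) (hΨ : Derivable S Ψ .valid) (h : EnvRel S Ψ Γ σ τ) :
    EnvRel S Ψ Γ σ σ := by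
  intro a x
  have P := TelePER.all S a
  have hK := P.kind_left (hΓ.lookup hΨ h x)
  exact P.abs_trans hK (h x) (P.abs_symm hK (h x))

theorem EnvRel.right (hΓ : SemCtx S Γ) (hΨ : Derivable S Ψ .valid) (h : EnvRel S Ψ Γ σ τ) :
    EnvRel S Ψ Γ τ τ := (h.symm hΓ hΨ).left hΓ hΨ

theorem Sub.init_cons {α a : Arity} (σ : Sub C g p) (H : AbsSeq C p (.snoc α a)) :
    Sub.init (σ.cons H) = σ.cons (AbsSeq.init H) := by
  apply funext_append
  · intro c y
    rw [Sub.cons_inl]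
    exact Sub.cons_inl (α := .snoc α a) σ H y
  · intro c v
    rw [Sub.cons_inr]
    exact Sub.cons_inr (α := .snoc α a) σ H (.prev v)

theorem Tele.final_inst_block {α a : Arity} (Θ : Tele C g (.snoc α a)) (σ : Sub C g p)
    (H : AbsSeq C p α) :
    (Θ.inst σ).final.inst (Sub.block H) = Θ.final.inst (σ.cons H) := by
  rw [Tele.final_inst, Kind.inst_inst, Sub.block_eq_cons, Sub.lift_comp_cons, Sub.comp_id]

theorem EnvRel.append (h : EnvRel S Ψ Γ σ τ) {α : Arity} {Θ : Tele C g α} {H H' : AbsSeq C p α}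
    (hH : SeqRel S α Ψ (Θ.inst σ) H H') :
    EnvRel S Ψ (Γ.append Θ) (σ.cons H) (τ.cons H') := by
  induction α with
  | nil => cases Θ; exact h
  | snoc α a ih _ =>
    cases Θ with
    | snoc Δ Θ T =>
    refine envRel_snoc.2 ⟨?_, ?_⟩
    · rw [Sub.init_cons, Sub.init_cons]
      exact ih hH.1
    · have := hH.2
      rw [Tele.final_inst_block] at this
      rw [Sub.init_cons]
      exact this

theorem SemCtx.of_append {α : Arity} {Θ : Tele C g α} (h : SemCtx S (Γ.append Θ)) :
    SemCtx S Γ := by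
  induction α with
  | nil => cases Θ; exact h
  | snoc α a ih _ => cases Θ; exact ih h.1

/-- The telescopes that extend a context to a semantically valid one are sent to related telescopes
by related environments. -/
theorem SemCtx.tele {α : Arity} {Θ : Tele C g α} (hΓ : SemCtx S (Γ.append Θ))
    (h : EnvRel S Ψ Γ σ τ) : TeleRel S α Ψ (Θ.inst σ) (Θ.inst τ) := by
  induction α with
  | nil => trivial
  | snoc α a ih _ =>
    cases Θ with
    | snoc Δ Θ T =>
    refine ⟨ih hΓ.1, ?_⟩
    intro q Ψ' ρ hρ H H' hH
    rw [Tele.final_inst, Tele.final_inst, Kind.inst_inst, Kind.inst_inst, Sub.lift_comp_cons,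
      Sub.lift_comp_cons]
    rw [Tele.init_inst, Tele.inst_inst] at hH
    exact hΓ.2 Ψ' _ _ hρ.valid ((h.mono hρ).append hH)

/-- Lifting a substitution amounts, up to long forms, to extending its weakening by the variables
of the block. -/
theorem Sub.comp_wk_cons_etaSeq (σ : Sub C g p) (α : Arity) :
    Sub.Equiv ((σ.comp (Sub.ofRen (Ren.wk p α))).cons (etaSeq C p α)) (σ.lift α) := by
  intro c x
  rcases Var.inl_or_inr α x with ⟨y, rfl⟩ | ⟨v, rfl⟩
  · rw [Sub.abs_lift_inl, Abs.rename, Obj.rename_eq_inst, ← Sub.lift_ofRen, ← Sub.abs_comp]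
    simp only [Sub.abs, Sub.cons_inl]
  · simp [Sub.abs, etaSeq]

/-- Related environments can be extended by the variables of a telescope. -/
theorem EnvRel.lift (hΨ : Derivable S Ψ .valid) (h : EnvRel S Ψ Γ σ τ) {α : Arity}
    {Θ : Tele C g α} (hΘ : TeleRel S α Ψ (Θ.inst σ) (Θ.inst σ)) :
    EnvRel S (Ψ.append (Θ.inst σ)) (Γ.append Θ) (σ.lift α) (τ.lift α) := by
  have E := Escape.all S α
  have hv := E.vars hΨ hΘ
  rw [Tele.inst_inst] at hv
  exact ((h.mono (Mor.append (E.valid hΨ hΘ))).append hv).congr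
    (Sub.comp_wk_cons_etaSeq σ α) (Sub.comp_wk_cons_etaSeq τ α)

/-- A semantically valid context is valid, and the identity is related to itself. -/
theorem SemCtx.valid_and_id (hΓ : SemCtx S Γ) :
    Derivable S Γ .valid ∧ EnvRel S Γ Γ (Sub.id g) (Sub.id g) := by
  induction Γ with
  | nil => exact ⟨.emp_ctxt, fun a x => nomatch x⟩
  | @snoc g a Γ K ih =>
    obtain ⟨hv, hid⟩ := ih hΓ.1
    have hK := hΓ.2 Γ _ _ hv hid
    rw [Kind.inst_id] at hK
    have E := Escape.all S a
    have hv' := E.snoc_valid hv hK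
    exact ⟨hv', envRel_snoc.2 ⟨hid.mono (Mor.snoc hv'), E.snoc_last hv hK⟩⟩

end

/-! ### Semantic judgements and the fundamental theorem -/

/-- The semantic counterpart of the bodies of judgements.  The base kind is required to be sent to
related base kinds as well, since symmetry and conversion move between its two instances. -/
def SemBody (S : Spec C) {g : Arity} (Γ : Ctx C g) : Body C g → Prop
  | .valid => True
  | .hasKind M T => ∀ ⦃p : Arity⦄ (Ψ : Ctx C p) (σ τ : Sub C g p), Derivable S Ψ .valid →
      EnvRel S Ψ Γ σ τ →
      BaseKindRel S Ψ (T.inst σ) (T.inst τ) ∧ BaseRel S Ψ (M.inst σ) (M.inst τ) (T.inst σ)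
  | .eq M N T => ∀ ⦃p : Arity⦄ (Ψ : Ctx C p) (σ τ : Sub C g p), Derivable S Ψ .valid →
      EnvRel S Ψ Γ σ τ →
      BaseKindRel S Ψ (T.inst σ) (T.inst τ) ∧ BaseRel S Ψ (M.inst σ) (N.inst τ) (T.inst σ)

/-- Semantic validity of a judgement: related environments send related things to related
things. -/
def Sem (S : Spec C) {g : Arity} (Γ : Ctx C g) (J : Body C g) : Prop :=
  SemCtx S Γ ∧ SemBody S Γ J

/-- The instance of a closed body with free variables `α` by an abstraction sequence. -/
abbrev Obj.instClosed {α p : Arity} (M : Obj C (.nil ⧺ α)) (H : AbsSeq C p α) : Obj C p :=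
  (M.rename (p ⧺ α) ((Ren.ofNil p).lift α)).inst (Sub.block H)

/-- The instance of a closed base kind with free variables `α` by an abstraction sequence. -/
abbrev BaseKind.instClosed {α p : Arity} (T : BaseKind C (.nil ⧺ α)) (H : AbsSeq C p α) :
    BaseKind C p :=
  (T.rename ((Ren.ofNil p).lift α)).inst (Sub.block H)

theorem Sub.ofRen_ofNil_lift_comp {α p q : Arity} (H : AbsSeq C p α) (σ : Sub C p q) :
    (Sub.comp (Sub.ofRen ((Ren.ofNil p).lift α)) (Sub.block H)).comp σ =
      Sub.comp (Sub.ofRen ((Ren.ofNil q).lift α)) (Sub.block (H.inst σ)) := by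
  apply funext_append
  · intro c y; cases y
  · intro c v
    simp [Sub.comp, Sub.ofRen, Sub.block_eq_cons, AbsSeq.inst]

theorem Obj.instClosed_inst {α p q : Arity} (M : Obj C (.nil ⧺ α)) (H : AbsSeq C p α)
    (σ : Sub C p q) : (M.instClosed H).inst σ = M.instClosed (H.inst σ) := by
  simp only [Obj.instClosed, Obj.rename_eq_inst, Obj.inst_inst, Sub.ofRen_ofNil_lift_comp]

theorem BaseKind.instClosed_inst {α p q : Arity} (T : BaseKind C (.nil ⧺ α)) (H : AbsSeq C p α)
    (σ : Sub C p q) : (T.instClosed H).inst σ = T.instClosed (H.inst σ) := by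
  simp only [BaseKind.instClosed, BaseKind.rename_eq_inst, BaseKind.inst_inst,
    Sub.ofRen_ofNil_lift_comp]

theorem Tele.rename_ofNil_inst {α p q : Arity} (Δ : Tele C .nil α) (σ : Sub C p q) :
    (Δ.rename p (Ren.ofNil p)).inst σ = Δ.rename q (Ren.ofNil q) := by
  rw [Tele.rename_eq_inst, Tele.rename_eq_inst, Tele.inst_inst]
  congr 1
  funext c x
  cases x

/-- Semantic validity of a declaration, in every valid context. -/
def SemDecl (S : Spec C) : Decl C → Prop
  | .const _ K => ∀ ⦃p : Arity⦄ (Ψ : Ctx C p), Derivable S Ψ .valid →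
      KindRel S Ψ (K.rename (Ren.ofNil p)) (K.rename (Ren.ofNil p))
  | .eqn (α := α) Δ M N T => ∀ ⦃p : Arity⦄ (Ψ : Ctx C p), Derivable S Ψ .valid →
      TeleRel S α Ψ (Δ.rename p (Ren.ofNil p)) (Δ.rename p (Ren.ofNil p)) ∧
      ∀ H H' : AbsSeq C p α, SeqRel S α Ψ (Δ.rename p (Ren.ofNil p)) H H' →
        BaseKindRel S Ψ (T.instClosed H) (T.instClosed H') ∧
        BaseRel S Ψ (M.instClosed H) (M.instClosed H') (T.instClosed H) ∧
        BaseRel S Ψ (N.instClosed H) (N.instClosed H') (T.instClosed H)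

section

variable {S : Spec C} {g p : Arity} {Ψ : Ctx C p} {Γ : Ctx C g} {σ τ : Sub C g p}

theorem Sem.baseKind {T : BaseKind C g} (h : Sem S (baseKindJ Γ T).ctx (baseKindJ Γ T).body) :
    SemCtx S Γ ∧ ∀ ⦃p : Arity⦄ (Ψ : Ctx C p) (σ τ : Sub C g p), Derivable S Ψ .valid →
      EnvRel S Ψ Γ σ τ → BaseKindRel S Ψ (T.inst σ) (T.inst τ) := by
  cases T with
  | type => exact ⟨h.1, fun _ _ _ _ _ _ => trivial⟩
  | el A => exact ⟨h.1, fun _ Ψ σ τ hΨ hσ => (h.2 Ψ σ τ hΨ hσ).2⟩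

/-- Relatedness of the instances of a body in all environments for `Γ, Θ` amounts to relatedness of
the abstractions in the environments for `Γ`. -/
theorem AbsRel.of_forall {a : Arity} {K : Kind C g a} {F G : Abs C g a}
    (h : ∀ ⦃q : Arity⦄ (Ψ' : Ctx C q) (σ τ : Sub C (g ⧺ a) q), Derivable S Ψ' .valid →
      EnvRel S Ψ' (Γ.append K.tele) σ τ → BaseRel S Ψ' (Obj.inst σ F) (Obj.inst τ G)
        (K.base.inst σ))
    (hσ : EnvRel S Ψ Γ σ τ) :
    AbsRel S Ψ (K.inst σ) (Obj.inst (σ.lift a) F) (Obj.inst (τ.lift a) G) := by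
  intro q Ψ' ρ hρ H H' hH
  simp only [Kind.inst, Tele.inst_inst] at hH
  simp only [Kind.inst, Obj.inst_inst, BaseKind.inst_inst, Sub.lift_comp_cons]
  exact h Ψ' _ _ hρ.valid ((hσ.mono hρ).append hH)

theorem Sem.kind {a : Arity} {K : Kind C g a}
    (h : Sem S (kindJ Γ K).ctx (kindJ Γ K).body) : SemCtx S (Γ.snoc K) := by
  obtain ⟨hΓ, hT⟩ := Sem.baseKind h
  refine ⟨hΓ.of_append, ?_⟩
  intro p Ψ σ τ hΨ hσ
  refine ⟨hΓ.tele hσ, ?_⟩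
  intro q Ψ' ρ hρ H H' hH
  simp only [Kind.inst, Tele.inst_inst] at hH
  simp only [Kind.inst, BaseKind.inst_inst, Sub.lift_comp_cons]
  exact hT Ψ' _ _ hρ.valid ((hσ.mono hρ).append hH)

/-- A semantically valid judgement `Γ ⊩ F⃗ :: Θ` sends related environments to related
sequences. -/
theorem Sem.sat {α : Arity} {F : AbsSeq C g α} {Θ : Tele C g α}
    (h : ∀ J ∈ satJ Γ F Θ, Sem S J.ctx J.body) :
    SemCtx S Γ ∧ ∀ ⦃p : Arity⦄ (Ψ : Ctx C p) (σ τ : Sub C g p), Derivable S Ψ .valid →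
      EnvRel S Ψ Γ σ τ → SeqRel S α Ψ (Θ.inst σ) (F.inst σ) (F.inst τ) := by
  induction α with
  | nil =>
    cases Θ
    exact ⟨(h _ rfl).1, fun _ _ _ _ _ _ => trivial⟩
  | snoc α a ih _ =>
    cases Θ with
    | snoc Δ Θ T =>
    obtain ⟨hΓ, hs⟩ := ih (F := AbsSeq.init F) (Θ := Δ) fun J hJ => h J (.inl hJ)
    refine ⟨hΓ, fun p Ψ σ τ hΨ hσ => ⟨hs Ψ σ τ hΨ hσ, ?_⟩⟩
    rw [Tele.final_inst, AbsSeq.init_inst, Kind.inst_lift_block]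
    exact AbsRel.of_forall (fun q Ψ' σ τ hΨ' h' => ((h _ (.inr rfl)).2 Ψ' σ τ hΨ' h').2) hσ

/-- A semantically valid judgement `Γ ⊩ F⃗ = G⃗ :: Θ` sends related environments to related
sequences. -/
theorem Sem.satEq {α : Arity} {F G : AbsSeq C g α} {Θ : Tele C g α}
    (h : ∀ J ∈ satEqJ Γ F G Θ, Sem S J.ctx J.body) :
    SemCtx S Γ ∧ ∀ ⦃p : Arity⦄ (Ψ : Ctx C p) (σ τ : Sub C g p), Derivable S Ψ .valid →
      EnvRel S Ψ Γ σ τ → SeqRel S α Ψ (Θ.inst σ) (F.inst σ) (G.inst τ) := by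
  induction α with
  | nil =>
    cases Θ
    exact ⟨(h _ rfl).1, fun _ _ _ _ _ _ => trivial⟩
  | snoc α a ih _ =>
    cases Θ with
    | snoc Δ Θ T =>
    obtain ⟨hΓ, hs⟩ :=
      ih (F := AbsSeq.init F) (G := AbsSeq.init G) (Θ := Δ) fun J hJ => h J (.inl hJ)
    refine ⟨hΓ, fun p Ψ σ τ hΨ hσ => ⟨hs Ψ σ τ hΨ hσ, ?_⟩⟩
    rw [Tele.final_inst, AbsSeq.init_inst, Kind.inst_lift_block]
    exact AbsRel.of_forall (fun q Ψ' σ τ hΨ' h' => ((h _ (.inr rfl)).2 Ψ' σ τ hΨ' h').2) hσ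

theorem KindRel.base_block {a : Arity} (hΨ : Derivable S Ψ .valid) {K K' : Kind C p a}
    (h : KindRel S Ψ K K') {H H' : AbsSeq C p a} (hH : SeqRel S a Ψ K.tele H H') :
    BaseKindRel S Ψ (K.base.inst (Sub.block H)) (K'.base.inst (Sub.block H')) :=
  h.2 Ψ _ (Mor.id hΨ) H H' (by rw [Sub.ofRen_id, Tele.inst_id]; exact hH)

theorem AbsRel.block {a : Arity} (hΨ : Derivable S Ψ .valid) {K : Kind C p a} {F G : Abs C p a}
    (h : AbsRel S Ψ K F G) {H H' : AbsSeq C p a} (hH : SeqRel S a Ψ K.tele H H') :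
    BaseRel S Ψ (Obj.inst (Sub.block H) F) (Obj.inst (Sub.block H') G)
      (K.base.inst (Sub.block H)) :=
  h Ψ _ (Mor.id hΨ) H H' (by rw [Sub.ofRen_id, Tele.inst_id]; exact hH)

/-- An equation declaration relates the instances of its sides: the instances of each side are
related, and the rule for the declaration links the two sides at a single instance. -/
theorem SemDecl.eqn_rel {α : Arity} {Δ : Tele C .nil α} {M N : Obj C (.nil ⧺ α)}
    {T : BaseKind C (.nil ⧺ α)} (hS : Decl.eqn Δ M N T ∈ S) (h : SemDecl S (.eqn Δ M N T))
    (hΨ : Derivable S Ψ .valid) {H H' : AbsSeq C p α}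
    (hH : SeqRel S α Ψ (Δ.rename p (Ren.ofNil p)) H H') :
    BaseRel S Ψ (M.instClosed H) (N.instClosed H') (T.instClosed H) := by
  obtain ⟨hΔ, hd⟩ := h Ψ hΨ
  obtain ⟨-, hM, hN⟩ := hd H H' hH
  intro q Ψ' ρ hρ
  have hN' := hN Ψ' ρ hρ
  refine ⟨(hM Ψ' ρ hρ).1, hN'.2.1, .trans ?_ hN'.2.2⟩
  rw [Obj.instClosed_inst, Obj.instClosed_inst, BaseKind.instClosed_inst]
  have hs := (Escape.all S α).sat hρ.valid (hΔ.mono hρ) (hH.mono hρ)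
  rw [Tele.rename_ofNil_inst] at hs
  exact Derivable.eq hS _ hs

end

/-- The fundamental theorem: what is derivable from semantically valid declarations is
semantically valid. -/
theorem Derivable.sem {S S' : Spec C} (hS : S' ⊆ S) (hD : ∀ δ ∈ S', SemDecl S δ) {g : Arity}
    {Γ : Ctx C g} {J : Body C g} (h : Derivable S' Γ J) : Sem S Γ J := by
  induction h with
  | emp_ctxt => exact ⟨trivial, trivial⟩
  | ctxt _ ih => exact ⟨ih.kind, trivial⟩
  | var x F _ ih =>
    obtain ⟨hΓ, hF⟩ := Sem.sat ih
    refine ⟨hΓ, fun p Ψ σ τ hΨ hσ => ?_⟩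
    have hs := hF Ψ σ τ hΨ hσ
    rw [BaseKind.inst_block_inst, BaseKind.inst_block_inst, Obj.inst_var, Obj.inst_var]
    exact ⟨(hΓ.lookup hΨ hσ x).base_block hΨ hs, (hσ x).block hΨ hs⟩
  | var_eq x F G _ ih =>
    obtain ⟨hΓ, hF⟩ := Sem.satEq ih
    refine ⟨hΓ, fun p Ψ σ τ hΨ hσ => ?_⟩
    have hs := hF Ψ σ τ hΨ hσ
    have hτ := hσ.right hΓ hΨ
    rw [BaseKind.inst_block_inst, BaseKind.inst_block_inst, Obj.inst_var, Obj.inst_var]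
    -- The kinds of `x[F⃗]` under `σ` and under `τ` are both related to that of `x[G⃗]` under `τ`.
    exact ⟨((hΓ.lookup hΨ hσ x).base_block hΨ hs).trans
      ((hΓ.lookup hΨ hτ x).base_block hΨ (hF Ψ τ τ hΨ hτ)).symm, (hσ x).block hΨ hs⟩
  | ref _ ih => exact ih
  | sym _ ih =>
    refine ⟨ih.1, fun p Ψ σ τ hΨ hσ => ?_⟩
    obtain ⟨hT, h⟩ := ih.2 Ψ τ σ hΨ (hσ.symm ih.1 hΨ)
    exact ⟨hT.symm, h.symm.conv hT⟩
  | trans _ _ ih ih' =>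
    refine ⟨ih.1, fun p Ψ σ τ hΨ hσ => ?_⟩
    have h := ih.2 Ψ σ σ hΨ (hσ.left ih.1 hΨ)
    have h' := ih'.2 Ψ σ τ hΨ hσ
    exact ⟨h'.1, h.2.trans h'.2⟩
  | @conv g Γ M A B _ _ ih ih' =>
    refine ⟨ih.1, fun p Ψ σ τ hΨ hσ => ?_⟩
    have hl : BaseKindRel S Ψ (.el (A.inst σ)) (.el (B.inst σ)) :=
      (ih'.2 Ψ σ σ hΨ (hσ.left ih.1 hΨ)).2
    have hr : BaseKindRel S Ψ (.el (A.inst τ)) (.el (B.inst τ)) :=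
      (ih'.2 Ψ τ τ hΨ (hσ.right ih.1 hΨ)).2
    have hM := ih.2 Ψ σ τ hΨ hσ
    exact ⟨hl.symm.trans (hM.1.trans hr), hM.2.conv hl⟩
  | @conv_eq g Γ M N A B _ _ ih ih' =>
    refine ⟨ih.1, fun p Ψ σ τ hΨ hσ => ?_⟩
    have hl : BaseKindRel S Ψ (.el (A.inst σ)) (.el (B.inst σ)) :=
      (ih'.2 Ψ σ σ hΨ (hσ.left ih.1 hΨ)).2
    have hr : BaseKindRel S Ψ (.el (A.inst τ)) (.el (B.inst τ)) :=
      (ih'.2 Ψ τ τ hΨ (hσ.right ih.1 hΨ)).2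
    have hM := ih.2 Ψ σ τ hΨ hσ
    exact ⟨hl.symm.trans (hM.1.trans hr), hM.2.conv hl⟩
  | @const g α Γ c K hc F _ ih =>
    obtain ⟨hΓ, hF⟩ := Sem.sat ih
    refine ⟨hΓ, fun p Ψ σ τ hΨ hσ => ?_⟩
    have hs : SeqRel S α Ψ ((K.rename (Ren.ofNil g)).inst σ).tele _ _ := hF Ψ σ τ hΨ hσ
    have hK := hD _ hc Ψ hΨ
    rw [BaseKind.inst_block_inst, BaseKind.inst_block_inst, Obj.inst_const, Obj.inst_const]
    change BaseKindRel S Ψ (((K.rename (Ren.ofNil g)).inst σ).base.inst _)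
      (((K.rename (Ren.ofNil g)).inst τ).base.inst _) ∧
      BaseRel S Ψ _ _ (((K.rename (Ren.ofNil g)).inst σ).base.inst _)
    rw [Kind.rename_ofNil_inst] at hs ⊢
    rw [Kind.rename_ofNil_inst]
    exact ⟨hK.base_block hΨ hs, (Escape.all S α).const (hS hc) hK hs⟩
  | @const_eq g α Γ c K hc F G _ ih =>
    obtain ⟨hΓ, hF⟩ := Sem.satEq ih
    refine ⟨hΓ, fun p Ψ σ τ hΨ hσ => ?_⟩
    have hs : SeqRel S α Ψ ((K.rename (Ren.ofNil g)).inst σ).tele _ _ := hF Ψ σ τ hΨ hσ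
    have hr : SeqRel S α Ψ ((K.rename (Ren.ofNil g)).inst τ).tele _ _ :=
      hF Ψ τ τ hΨ (hσ.right hΓ hΨ)
    have hK := hD _ hc Ψ hΨ
    rw [BaseKind.inst_block_inst, BaseKind.inst_block_inst, Obj.inst_const, Obj.inst_const]
    change BaseKindRel S Ψ (((K.rename (Ren.ofNil g)).inst σ).base.inst _)
      (((K.rename (Ren.ofNil g)).inst τ).base.inst _) ∧
      BaseRel S Ψ _ _ (((K.rename (Ren.ofNil g)).inst σ).base.inst _)
    rw [Kind.rename_ofNil_inst] at hs hr ⊢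
    rw [Kind.rename_ofNil_inst]
    -- As for variables, the two instances of the kind are compared through that of `c[G⃗]`.
    exact ⟨(hK.base_block hΨ hs).trans (hK.base_block hΨ hr).symm,
      (Escape.all S α).const (hS hc) hK hs⟩
  | @eq g α Γ Δ M N T he F _ ih =>
    obtain ⟨hΓ, hF⟩ := Sem.sat ih
    refine ⟨hΓ, fun p Ψ σ τ hΨ hσ => ?_⟩
    have hs := hF Ψ σ τ hΨ hσ
    rw [Tele.rename_ofNil_inst] at hs
    have hd := hD _ he
    rw [T.instClosed_inst F σ, T.instClosed_inst F τ, M.instClosed_inst F σ,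
      N.instClosed_inst F τ]
    exact ⟨((hd Ψ hΨ).2 _ _ hs).1, hd.eqn_rel (hS he) hΨ hs⟩

/-! ### Orderable specifications -/

theorem Kind.rename_ofNil_eq_inst {p a : Arity} (K : Kind C .nil a) (σ : Sub C .nil p) :
    K.rename (Ren.ofNil p) = K.inst σ := by
  rw [Kind.rename_eq_inst]
  congr 1
  funext c x
  cases x

theorem Tele.rename_ofNil_eq_inst {p α : Arity} (Δ : Tele C .nil α) (σ : Sub C .nil p) :
    Δ.rename p (Ren.ofNil p) = Δ.inst σ := by
  rw [Tele.rename_eq_inst]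
  congr 1
  funext c x
  cases x

theorem Sub.ofNil_cons {p α : Arity} (σ : Sub C .nil p) (H : AbsSeq C p α) :
    Sub.comp (Sub.ofRen ((Ren.ofNil p).lift α)) (Sub.block H) = σ.cons H := by
  apply funext_append
  · intro c y; cases y
  · intro c v
    simp [Sub.comp, Sub.ofRen, Sub.block_eq_cons]

/-- A declaration that is well-formed over semantically valid declarations is semantically valid. -/
theorem Decl.WellFormed.sem {S S' : Spec C} (hS : S' ⊆ S) (hD : ∀ δ ∈ S', SemDecl S δ)
    {δ : Decl C} (h : δ.WellFormed S') : SemDecl S δ := by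
  cases δ with
  | const c K =>
    intro p Ψ hΨ
    have hK : SemCtx S (Ctx.nil.snoc K) := Sem.kind (Derivable.sem hS hD h)
    have σ : Sub C .nil p := fun _ x => nomatch x
    have := hK.2 Ψ σ σ hΨ (fun a x => nomatch x)
    rwa [← Kind.rename_ofNil_eq_inst] at this
  | @eqn α Δ M N T =>
    obtain ⟨hM, hN, -⟩ := h
    have hM := hM.sem hS hD
    have hN := hN.sem hS hD
    intro p Ψ hΨ
    have σ : Sub C .nil p := fun _ x => nomatch x
    have hσ : EnvRel S Ψ .nil σ σ := fun a x => nomatch x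
    rw [Tele.rename_ofNil_eq_inst Δ σ]
    refine ⟨hM.1.tele hσ, fun H H' hH => ?_⟩
    have h1 := hM.2 Ψ _ _ hΨ (hσ.append hH)
    have h2 := hN.2 Ψ _ _ hΨ (hσ.append hH)
    simp only [Obj.instClosed, BaseKind.instClosed, Obj.rename_eq_inst, BaseKind.rename_eq_inst,
      Obj.inst_inst, BaseKind.inst_inst, Sub.ofNil_cons σ]
    exact ⟨h1.1, h1.2, h2.2⟩

/-- The declarations of an orderable specification are semantically valid, by induction along the
well-ordering. -/
theorem Orderable.semDecl {S : Spec C} (h : Orderable S) : ∀ δ ∈ S, SemDecl S δ := by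
  obtain ⟨r, hr, hwf⟩ := h
  have key : ∀ δ : S, SemDecl S δ := by
    intro δ
    induction δ using hr.wf.induction with
    | _ δ ih =>
    refine (hwf δ).sem ?_ ?_
    · rintro d ⟨hd, -⟩
      exact hd
    · rintro d ⟨hd, hlt⟩
      exact ih ⟨d, hd⟩ hlt
  exact fun δ hδ => key ⟨δ, hδ⟩

theorem Orderable.sem {S : Spec C} (h : Orderable S) {g : Arity} {Γ : Ctx C g} {J : Body C g}
    (hJ : Derivable S Γ J) : Sem S Γ J :=
  hJ.sem subset_rfl h.semDecl

section

variable {S : Spec C} {g p : Arity} {Ψ : Ctx C p} {Γ : Ctx C g} {σ τ : Sub C g p}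

theorem Sem.eq_sides {M N : Obj C g} {T : BaseKind C g} (h : Sem S Γ (.eq M N T)) :
    Derivable S Γ (.hasKind M T) ∧ Derivable S Γ (.hasKind N T) := by
  obtain ⟨hv, hid⟩ := h.1.valid_and_id
  have := (h.2 Γ _ _ hv hid).2
  rw [Obj.inst_id, Obj.inst_id, BaseKind.inst_id] at this
  exact ⟨(this.derivable hv).1, (this.derivable hv).2.1⟩

/-- Semantically valid judgements are derivable in every environment related to itself. -/
theorem Sem.inst {J : Body C g} (h : Sem S Γ J) (hΨ : Derivable S Ψ .valid)
    (hσ : EnvRel S Ψ Γ σ σ) : Derivable S Ψ (J.inst σ) := by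
  cases J with
  | valid => exact hΨ
  | hasKind M T => exact (BaseRel.derivable hΨ (h.2 Ψ σ σ hΨ hσ).2).1
  | eq M N T => exact (BaseRel.derivable hΨ (h.2 Ψ σ σ hΨ hσ).2).2.2

theorem Sem.absEq {a : Arity} {F G : Abs C g a} {K : Kind C g a}
    (h : Sem S (absEqJ Γ F G K).ctx (absEqJ Γ F G K).body) : AbsRel S Γ K F G := by
  obtain ⟨hv, hid⟩ := h.1.of_append.valid_and_id
  have := AbsRel.of_forall (fun q Ψ' σ τ hΨ' h' => (h.2 Ψ' σ τ hΨ' h').2) hid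
  rwa [Sub.lift_id, Obj.inst_id, Obj.inst_id, Kind.inst_id] at this

theorem Sem.absKind {a : Arity} {F : Abs C g a} {K : Kind C g a}
    (h : Sem S (absJ Γ F K).ctx (absJ Γ F K).body) : AbsRel S Γ K F F :=
  Sem.absEq (G := F) h

theorem EnvRel.single (hid : EnvRel S Γ Γ (Sub.id g) (Sub.id g)) {a : Arity} {F G : Abs C g a}
    {K : Kind C g a} (h : AbsRel S Γ K F G) :
    EnvRel S Γ (Γ.snoc K) (Sub.single F) (Sub.single G) := by
  refine envRel_snoc.2 ⟨hid, ?_⟩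
  change AbsRel S Γ (K.inst (Sub.id g)) F G
  rwa [Kind.inst_id]

theorem Orderable.baseKindRel (hS : Orderable S) {T T' : BaseKind C g}
    (h : BaseKindEq S Γ T T') (hΨ : Derivable S Ψ .valid) (hσ : EnvRel S Ψ Γ σ τ) :
    BaseKindRel S Ψ (T.inst σ) (T'.inst τ) := by
  cases T <;> cases T'
  · trivial
  · exact h.elim
  · exact h.elim
  · exact ((hS.sem h).2 Ψ σ τ hΨ hσ).2

end

theorem Orderable.teleRel {S : Spec C} (hS : Orderable S) {α : Arity} : ∀ {g p : Arity}
    {Ψ : Ctx C p} {Γ : Ctx C g} {σ τ : Sub C g p} {Δ Δ' : Tele C g α}, TeleEq S Γ Δ Δ' →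
    EnvRel S Ψ Γ σ τ → TeleRel S α Ψ (Δ.inst σ) (Δ'.inst τ) := by
  induction α with
  | nil => intros; trivial
  | snoc α a ih ih' =>
    intro g p Ψ Γ σ τ Δ Δ' h hσ
    cases Δ with
    | snoc Δ Θ T =>
    cases Δ' with
    | snoc Δ' Θ' T' =>
    obtain ⟨hΔ, hΘ, hT⟩ := h
    refine ⟨ih hΔ hσ, ?_⟩
    intro q Ψ' ρ hρ H H' hH
    rw [Tele.init_inst, Tele.inst_inst] at hH
    have hσ' := (hσ.mono hρ).append hH
    rw [Tele.final_inst, Tele.final_inst, Kind.inst_inst, Kind.inst_inst, Sub.lift_comp_cons,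
      Sub.lift_comp_cons]
    refine ⟨ih' hΘ hσ', ?_⟩
    intro r Ψ'' θ hθ I I' hI
    simp only [Kind.inst, Tele.inst_inst] at hI
    simp only [Kind.inst, BaseKind.inst_inst, Sub.lift_comp_cons]
    exact hS.baseKindRel hT hθ.valid ((hσ'.mono hθ).append hI)

theorem Orderable.kindRel {S : Spec C} (hS : Orderable S) {g a p : Arity} {Ψ : Ctx C p}
    {Γ : Ctx C g} {σ τ : Sub C g p} {K K' : Kind C g a} (h : KindEq S Γ K K')
    (hσ : EnvRel S Ψ Γ σ τ) : KindRel S Ψ (K.inst σ) (K'.inst τ) := by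
  refine ⟨hS.teleRel h.1 hσ, ?_⟩
  intro q Ψ' ρ hρ H H' hH
  simp only [Kind.inst, Tele.inst_inst] at hH
  simp only [Kind.inst, BaseKind.inst_inst, Sub.lift_comp_cons]
  exact hS.baseKindRel h.2 hρ.valid ((hσ.mono hρ).append hH)

/-! ### The metatheorems -/

theorem Orderable.nGood {S : Spec C} (hS : Orderable S) (n : ℕ) : NGood n S :=
  fun _ _ _ _ _ h => (hS.sem h).eq_sides

theorem Orderable.cut {S : Spec C} (hS : Orderable S) (n : ℕ) : Cut n S := by
  intro g a d Γ K Δ J F _ hJ hF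
  have hJ := hS.sem hJ
  have hF := hS.sem hF
  obtain ⟨hv, hid⟩ := hF.1.of_append.valid_and_id
  have hσ := EnvRel.single hid hF.absKind
  have hΔ := hJ.1.tele hσ
  exact hJ.inst ((Escape.all S d).valid hv hΔ) (hσ.lift hv hΔ)

theorem Orderable.functionality {S : Spec C} (hS : Orderable S) (n : ℕ) : Functionality n S := by
  intro g a d Γ K Δ M T F G _ hM hF
  have hM := hS.sem hM
  have hF := hS.sem hF
  obtain ⟨hv, hid⟩ := hF.1.of_append.valid_and_id
  have hσ := EnvRel.single hid hF.absEq
  have hΔ := hM.1.tele (hσ.left hM.1.of_append hv)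
  have hv' := (Escape.all S d).valid hv hΔ
  exact ((hM.2 _ _ _ hv' (hσ.lift hv hΔ)).2.derivable hv').2.2

theorem Orderable.contextConversion {S : Spec C} (hS : Orderable S) (n : ℕ) :
    ContextConversion n S := by
  intro g a d Γ K K' Δ J _ hJ hK
  have hJ := hS.sem hJ
  have P := TelePER.all S a
  have E := Escape.all S a
  obtain ⟨hv, hid⟩ := hJ.1.of_append.1.valid_and_id
  have hK := hS.kindRel hK hid
  rw [Kind.inst_id, Kind.inst_id] at hK
  have hK' := P.kind_left (P.kind_symm hK)
  have hv' := E.snoc_valid hv hK'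
  -- The last variable has the kind `K'`, hence also the kind `K`.
  have hσ : EnvRel S (Γ.snoc K') (Γ.snoc K) (Sub.id _) (Sub.id _) :=
    envRel_snoc.2 ⟨hid.mono (Mor.snoc hv'),
      P.abs_conv ((P.kind_symm hK).mono (Mor.snoc hv')) (E.snoc_last hv hK')⟩
  have hΔ := hJ.1.tele hσ
  have := hσ.lift hv' hΔ
  rw [Sub.lift_id, Tele.inst_id] at this
  rw [Tele.inst_id] at hΔ
  have := hJ.inst ((Escape.all S d).valid hv' hΔ) this
  cases J <;> simpa only [Body.inst, Obj.inst_id, BaseKind.inst_id] using this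

/-! ### Specifications without equations -/

/-- If `P` forces equations to be syntactic identities between objects of the right kind, it forces
the same for `Γ ⊩ F⃗ = G⃗ :: Θ`. -/
theorem eq_and_sat_of_satEqJ {S : Spec C} {g : Arity} {Γ : Ctx C g}
    {P : ∀ {g : Arity}, Ctx C g → Body C g → Prop}
    (hP : ∀ {g : Arity} {Γ : Ctx C g} {M N : Obj C g} {T : BaseKind C g},
      P Γ (.eq M N T) → M = N ∧ Derivable S Γ (.hasKind M T))
    (hP' : ∀ {g : Arity} {Γ : Ctx C g}, P Γ .valid → Derivable S Γ .valid)
    {α : Arity} {F G : AbsSeq C g α} {Θ : Tele C g α}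
    (h : ∀ J ∈ satEqJ Γ F G Θ, P J.ctx J.body) :
    F = G ∧ ∀ J ∈ satJ Γ F Θ, Derivable S J.ctx J.body := by
  induction α with
  | nil =>
    cases Θ
    refine ⟨funext fun c => funext fun v => (nomatch v), fun J hJ => ?_⟩
    rw [satJ, Set.mem_singleton_iff] at hJ
    subst hJ
    exact hP' (h _ rfl)
  | snoc α a ih _ =>
    cases Θ with
    | snoc Δ Θ T =>
    obtain ⟨e, hs⟩ := ih (F := AbsSeq.init F) (G := AbsSeq.init G) (Θ := Δ)
      fun J hJ => h J (.inl hJ)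
    obtain ⟨e', hs'⟩ := hP (h _ (.inr rfl))
    constructor
    · funext c v
      cases v with
      | last => exact e'
      | prev v => exact congrFun (congrFun e c) v
    · rintro J (hJ | hJ)
      · exact hs J hJ
      · rw [Set.mem_singleton_iff] at hJ
        subst hJ
        exact hs'

/-- Derivability of a judgement, with an equation read as the syntactic identity of two objects of
its base kind.  Without equation declarations all derivable judgements satisfy this. -/
def SyntacticEq (S : Spec C) {g : Arity} (Γ : Ctx C g) : Body C g → Prop
  | .eq M N T => M = N ∧ Derivable S Γ (.hasKind M T)
  | J => Derivable S Γ J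

theorem Derivable.syntacticEq {S : Spec C} (hS : ∀ δ ∈ S, ¬ δ.IsEquation) {g : Arity}
    {Γ : Ctx C g} {J : Body C g} (h : Derivable S Γ J) : SyntacticEq S Γ J := by
  induction h with
  | emp_ctxt => exact .emp_ctxt
  | ctxt h _ => exact .ctxt h
  | var x F h _ => exact .var x F h
  | var_eq x F G _ ih =>
    obtain ⟨rfl, hs⟩ := eq_and_sat_of_satEqJ (S := S) (P := SyntacticEq S) id id ih
    exact ⟨rfl, .var x F hs⟩
  | ref h _ => exact ⟨rfl, h⟩
  | sym _ ih =>
    obtain ⟨rfl, h⟩ := ih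
    exact ⟨rfl, h⟩
  | trans _ _ ih ih' =>
    obtain ⟨rfl, h⟩ := ih
    exact ih'
  | conv h h' _ _ => exact h.conv h'
  | conv_eq _ h' ih _ => exact ⟨ih.1, ih.2.conv h'⟩
  | const hc F h _ => exact .const hc F h
  | const_eq hc F G _ ih =>
    obtain ⟨rfl, hs⟩ := eq_and_sat_of_satEqJ (S := S) (P := SyntacticEq S) id id ih
    exact ⟨rfl, .const hc F hs⟩
  | eq he F _ _ => exact (hS _ he trivial).elim

theorem good_of_no_equations {S : Spec C} (hS : ∀ δ ∈ S, ¬ δ.IsEquation) : Good S := by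
  intro n g Γ _ M N T h
  obtain ⟨rfl, hM⟩ := h.syntacticEq hS
  exact ⟨hM, hM⟩

end TF

theorem mainTheorem2 {C : TF.Arity → Type*} (S : TF.Spec C) :
    ((∀ δ ∈ S, ¬ δ.IsEquation) → TF.Good S) ∧
    (TF.Orderable S → S.order ≤ 2 →
      TF.NGood 2 S ∧ TF.Cut 2 S ∧ TF.Functionality 2 S ∧ TF.ContextConversion 2 S) :=
  ⟨TF.good_of_no_equations, fun h _ =>
    ⟨h.nGood 2, h.cut 2, h.functionality 2, h.contextConversion 2⟩⟩
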